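/- Let $n,d\ge 1$. Let $v_1,\dots,v_n$ and $w_1,\dots,w_d$ be the vertices of the standard simplices $\Delta_{n-1}\subset\mathbb{R}^n$ and $\Delta_{d-1}\subset\mathbb{R}^d$, and let $K_{n,d}$ be the complete bipartite graph on $v_1,\dots,v_n$ and $w_1,\dots,w_d$. A subgraph $t$ of $K_{n,d}$ determines the set $V(t)$ of those vertices $v_i\times w_j$ of the polytope $P=\Delta_{n-1}\times\Delta_{d-1}$ for which $v_iw_j$ is an edge of $t$. A collection $T$ of subgraphs of $K_{n,d}$ is said to encode a triangulation of $P$ if the sets $V(t)$, $t\in T$, are the vertex sets of simplices of full dimension $n+d-2$ whose union is $P$ and any two of which intersect in a (possibly empty) common face. Let $T$ be a non-empty collection of subgraphs of $K_{n,d}$. Then $T$ encodes a triangulation of $\Delta_{n-1}\times\Delta_{d-1}$ if and only if the following three conditions hold. 1. Each $t\in T$ is a spanning tree of $K_{n,d}$. 2. For each $t\in T$ and each internal edge $e$ of $t$ (an edge neither of whose endpoints is a leaf of $t$, a leaf being a vertex with exactly one neighbour in $t$), there exist an edge $f\ne e$ of $K_{n,d}$ and a $t'\in T$ with $t'=(t-e)\cup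 f$. 3. There do not exist two members $t,s$ of $T$ and a circuit $C$ of $K_{n,d}$ whose edges, taken in cyclic order, lie alternately in $t$ and in $s$. (An edge of $C$ may lie in both.) -/

import Mathlib

/-- `F` is a face of the simplex with vertex set `σ`: the convex hull of some (possibly empty)
set of vertices of that simplex. -/
def IsSimplexFace {E : Type*} [AddCommGroup E] [Module ℝ E] (F σ : Set E) : Prop :=
  ∃ ρ ⊆ σ, F = convexHull ℝ ρ

/-- The collection `S` of vertex sets is (the collection of maximal cells of) a triangulation of
the polytope `P`: a tiling of `P` by finitely many full-dimensional simplices, whose vertices are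
vertices of `P`, such that the intersection of any two of them is a face of both. -/
structure IsTriangulation {E : Type*} [AddCommGroup E] [Module ℝ E]
    (P : Set E) (S : Set (Set E)) : Prop where
  finite : S.Finite
  vertices : ∀ σ ∈ S, σ ⊆ P.extremePoints ℝ
  simplex : ∀ σ ∈ S, AffineIndependent ℝ ((↑) : σ → E)
  full_dim : ∀ σ ∈ S, affineSpan ℝ σ = affineSpan ℝ P
  cover : ⋃ σ ∈ S, convexHull ℝ σ = P
  inter_face : ∀ σ ∈ S, ∀ τ ∈ S,
    IsSimplexFace (convexHull ℝ σ ∩ convexHull ℝ τ) σ ∧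
    IsSimplexFace (convexHull ℝ σ ∩ convexHull ℝ τ) τ

/-- The polytope `Δ_{n-1} × Δ_{d-1}` in `ℝⁿ × ℝᵈ`. -/
def productOfSimplices (n d : ℕ) : Set ((Fin n → ℝ) × (Fin d → ℝ)) :=
  stdSimplex ℝ (Fin n) ×ˢ stdSimplex ℝ (Fin d)

/-- The vertex `v_i × w_j` of `Δ_{n-1} × Δ_{d-1}`. -/
def productVertex {n d : ℕ} (i : Fin n) (j : Fin d) : (Fin n → ℝ) × (Fin d → ℝ) :=
  (Pi.single i 1, Pi.single j 1)

/-- The complete bipartite graph `K_{n,d}`; its vertices are `v_i = Sum.inl i` and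
`w_j = Sum.inr j`. -/
abbrev bipartiteK (n d : ℕ) : SimpleGraph (Fin n ⊕ Fin d) :=
  completeBipartiteGraph (Fin n) (Fin d)

/-- The set of vertices `v_i × w_j` of `Δ_{n-1} × Δ_{d-1}` that correspond to the edges
`v_i w_j` of the subgraph `t` of `K_{n,d}`. -/
def encodedVertices {n d : ℕ} (t : (bipartiteK n d).Subgraph) :
    Set ((Fin n → ℝ) × (Fin d → ℝ)) :=
  {x | ∃ i j, t.Adj (Sum.inl i) (Sum.inr j) ∧ x = productVertex i j}

/-- The collection `T` of subgraphs of `K_{n,d}` encodes a triangulation of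
`Δ_{n-1} × Δ_{d-1}`. -/
def EncodesTriangulation {n d : ℕ} (T : Set (bipartiteK n d).Subgraph) : Prop :=
  IsTriangulation (productOfSimplices n d) (encodedVertices '' T)

/-- The subgraph `t` of `G` is a spanning tree of `G`. -/
def IsSpanningTree {V : Type*} {G : SimpleGraph V} (t : G.Subgraph) : Prop :=
  t.IsSpanning ∧ t.coe.IsTree

/-- `v` is a leaf of `t`: a vertex with exactly one neighbour. -/
def IsLeafOf {V : Type*} {G : SimpleGraph V} (t : G.Subgraph) (v : V) : Prop :=
  ∃! w, t.Adj v w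

/-- `e` is an internal edge of `t`: an edge no endpoint of which is a leaf. -/
def IsInternalEdge {V : Type*} {G : SimpleGraph V} (t : G.Subgraph) (e : Sym2 V) : Prop :=
  e ∈ t.edgeSet ∧ ∀ v ∈ e, ¬ IsLeafOf t v

/-- The edges of the closed walk `c` lie alternately in `t` and in `s`: for `k` even the `k`-th
edge is in `t`, for `k` odd it is in `s`. -/
def AlternatesBetween {V : Type*} {G : SimpleGraph V} {v : V} (c : G.Walk v v)
    (t s : G.Subgraph) : Prop :=
  ∀ k < c.length,
    (Even k → t.Adj (c.getVert k) (c.getVert (k + 1))) ∧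
    (Odd k → s.Adj (c.getVert k) (c.getVert (k + 1)))

/-!
A matrix `a`, indexed by the edges of `K_{n,d}`, gives the linear combination
`marginals a = ∑ a (i, j) • (v_i × w_j)`, whose coordinates are the row and column sums of `a`. All
the vertices `v_i × w_j` lie on one affine hyperplane that misses the origin, so the polytope can be
replaced by the cone over it: `encodesTriangulation_iff` says that `T` encodes a triangulation if and
only if

* every `t ∈ T` gives a basis of the span of all the vertices (`IsCoordinateSet`),
* a point has at most one representation with nonnegative coefficients supported on a member of `T`
  (`HasUniqueRepresentations`), and
* every nonnegative combination of the vertices has such a representation.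

The first condition holds exactly when `t` is a spanning tree
(`isSpanningTree_iff_isCoordinateSet`). The second one is the absence of alternating cycles
(`hasUniqueRepresentations_iff`): the difference of two representations of a point has vanishing row
and column sums, and leaving each `v_i` along a positive entry and each `w_j` along a negative entry
closes up to an alternating cycle (`exists_alternating_cycle`); conversely the even and the odd edges
of an alternating cycle have the same sum (`exists_ne_of_alternating_cycle`).

Given the first two conditions, the third one is equivalent to the existence of flips. If the cells
cover the polytope, a point of an interior wall of `t` pushed slightly out of `t` lies in another
cell, which contains the wall and so is a flip of `t` (`exists_flip_of_cover`). If all flips exist,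
follow a segment from a generic point of one cell to a given point
(`exists_nonneg_representation_of_flips`). By genericity the segment avoids all faces of codimension
two. Whenever it leaves a cell it does so through the relative interior of a wall; that wall is not
on the boundary of the polytope, so a flip exists, and the flipped cell lies on the other side of
the wall because otherwise the two cells would overlap.
-/

/-! ### Simplicial cones and a covering criterion -/

section Covering

open Filter Topology

variable {E W : Type*} [Fintype E] [AddCommGroup W] [Module ℝ W]

/-- Every linear combination of the vectors `v e` has exactly one representation with coefficients
supported on `t`; that is, the `v e` with `e ∈ t` form a basis of the span of all the `v e`. -/
def IsCoordinateSet (v : E → W) (t : Set E) : Prop :=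
  (∀ c : E → ℝ, ∃ a : E → ℝ, (∀ e ∉ t, a e = 0) ∧
    Fintype.linearCombination ℝ v a = Fintype.linearCombination ℝ v c) ∧
  ∀ a b : E → ℝ, (∀ e ∉ t, a e = 0) → (∀ e ∉ t, b e = 0) →
    Fintype.linearCombination ℝ v a = Fintype.linearCombination ℝ v b → a = b

/-- Cones over two members of the family `T` meet only in the cone over their common vectors: a
point has at most one representation with nonnegative coefficients supported on a member of `T`. -/
def HasUniqueRepresentations (v : E → W) (T : Set (Set E)) : Prop :=
  ∀ t ∈ T, ∀ s ∈ T, ∀ a b : E → ℝ, (∀ e ∉ t, a e = 0) → (∀ e ∉ s, b e = 0) →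
    0 ≤ a → 0 ≤ b → Fintype.linearCombination ℝ v a = Fintype.linearCombination ℝ v b → a = b

lemma IsCoordinateSet.eq_of_subset {v : E → W} {A B : Set E} (hA : IsCoordinateSet v A)
    (hB : IsCoordinateSet v B) (h : A ⊆ B) : A = B := by
  classical
  refine h.antisymm fun g hg => by_contra fun hgA => ?_
  obtain ⟨a, ha, hav⟩ := hA.1 (Pi.single g 1)
  have := hB.2 a (Pi.single g 1) (fun e he => ha e fun h' => he (h h'))
    (fun e he => Pi.single_eq_of_ne (fun h' : e = g => he (h' ▸ hg)) _) hav
  have h1 := congrFun this g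
  rw [ha g hgA, Pi.single_eq_same] at h1
  exact zero_ne_one h1

/-- Two coordinate sets that share all but one element of the first differ by an exchange of a
single element. -/
lemma IsCoordinateSet.exists_eq_insert {v : E → W} {A B : Set E} (hA : IsCoordinateSet v A)
    (hB : IsCoordinateSet v B) {e : E} (he : e ∈ A) (hAB : A \ {e} ⊆ B) (hne : A ≠ B) :
    ∃ f ∉ A, B = insert f (A \ {e}) := by
  classical
  have heB : e ∉ B := fun h => hne <| hA.eq_of_subset hB fun g hg => by
    by_cases hge : g = e
    · exact hge ▸ h
    · exact hAB ⟨hg, hge⟩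
  have hsingle : ∀ {C : Set E} {g : E}, g ∈ C → ∀ k ∉ C, (Pi.single g 1 : E → ℝ) k = 0 :=
    fun {C g} hg k hk => Pi.single_eq_of_ne (fun h : k = g => hk (h ▸ hg)) _
  obtain ⟨μ, hμ, hμe⟩ := hB.1 (Pi.single e 1)
  have hf : ∃ f ∈ B, f ∉ A ∧ μ f ≠ 0 := by
    by_contra! h
    have := hA.2 μ (Pi.single e 1) (fun g hg => by
      by_cases hgB : g ∈ B
      · exact h g hgB hg
      · exact hμ g hgB) (hsingle he) hμe
    have h1 := congrFun this e
    rw [hμ e heB, Pi.single_eq_same] at h1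
    exact zero_ne_one h1
  obtain ⟨f, hfB, hfA, hμf⟩ := hf
  refine ⟨f, hfA, Set.Subset.antisymm (fun g hg => ?_) (Set.insert_subset hfB hAB)⟩
  by_contra hg'
  simp only [Set.mem_insert_iff, not_or] at hg'
  have hge : g ≠ e := fun h => heB (h ▸ hg)
  have hgA : g ∉ A := fun h => hg'.2 ⟨h, hge⟩
  -- Expand `v g` over `A`, then `v e` over `B`, and compare coefficients over `B`.
  obtain ⟨ν, hν, hνg⟩ := hA.1 (Pi.single g 1)
  have := hB.2 (ν + ν e • (μ - Pi.single e 1)) (Pi.single g 1) (fun k hk => by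
    by_cases hke : k = e
    · subst hke; simp [hμ k hk]
    · have hkA : k ∉ A := fun h => hk (hAB ⟨h, hke⟩)
      simp [hν k hkA, hμ k hk, hke]) (hsingle hg) (by
    rw [map_add, map_smul, map_sub, hμe, sub_self, smul_zero, add_zero, hνg])
  have hfe : f ≠ e := fun h => hfA (h ▸ he)
  have h1 := congrFun this f
  have h2 := congrFun this g
  simp only [Pi.add_apply, Pi.smul_apply, Pi.sub_apply, smul_eq_mul, hν f hfA, hν g hgA,
    Pi.single_eq_of_ne hfe, Pi.single_eq_of_ne hge, Pi.single_eq_of_ne (Ne.symm hg'.1),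
    Pi.single_eq_same, sub_zero, zero_add] at h1 h2
  rw [(mul_eq_zero.1 h1).resolve_right hμf, zero_mul] at h2
  exact zero_ne_one h2

/-- Finitely many linear forms, none of which vanishes on all the `v e` with `e ∈ t`, are
simultaneously nonzero at some point in the open cone over `t`. The point is found on the moment
curve. -/
lemma exists_pos_forall_ne_zero (t : Set E) {ι : Type*} [Finite ι] (ℓ : ι → (E → ℝ))
    (hℓ : ∀ i, ∃ e ∈ t, ℓ i e ≠ 0) :
    ∃ a : E → ℝ, (∀ e ∈ t, 0 < a e) ∧ (∀ e ∉ t, a e = 0) ∧ ∀ i, ∑ e, a e * ℓ i e ≠ 0 := by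
  classical
  have := Fintype.ofFinite ι
  let k := Fintype.equivFin E
  let P : ι → Polynomial ℝ := fun i =>
    ∑ e, if e ∈ t then Polynomial.C (ℓ i e) * Polynomial.X ^ (k e : ℕ) else 0
  have hP : ∀ i, P i ≠ 0 := by
    intro i h0
    obtain ⟨e, he, hne⟩ := hℓ i
    apply hne
    have := congrArg (fun p => p.coeff (k e : ℕ)) h0
    simp only [P, Polynomial.finsetSum_coeff, Polynomial.coeff_zero] at this
    rw [Finset.sum_eq_single e] at this
    · simpa [he] using this
    · intro b _ hb
      split_ifs
      · rw [Polynomial.coeff_C_mul_X_pow, if_neg]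
        intro h
        exact hb (k.injective (Fin.ext h.symm))
      · simp
    · simp
  have hQ : (∏ i, P i) ≠ 0 := Finset.prod_ne_zero_iff.2 fun i _ => hP i
  obtain ⟨x, hx, hroot⟩ : ∃ x ∈ Set.Ioi (0 : ℝ), ¬ (∏ i, P i).IsRoot x := by
    by_contra! h
    exact hQ (Polynomial.eq_zero_of_infinite_isRoot _ ((Set.Ioi_infinite (0 : ℝ)).mono h))
  refine ⟨fun e => if e ∈ t then x ^ (k e : ℕ) else 0, ?_, ?_, ?_⟩
  · intro e he
    simpa [he] using pow_pos hx _
  · intro e he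
    simp [he]
  · intro i h0
    apply hroot
    rw [Polynomial.IsRoot, Polynomial.eval_prod]
    refine Finset.prod_eq_zero (Finset.mem_univ i) ?_
    rw [← h0, Polynomial.eval_finsetSum]
    refine Finset.sum_congr rfl fun e _ => ?_
    dsimp only
    split_ifs
    · rw [Polynomial.eval_mul, Polynomial.eval_C, Polynomial.eval_pow, Polynomial.eval_X, mul_comm]
    · rw [Polynomial.eval_zero, zero_mul]

/-- The new vector `v f` of a flip lies on the far side of the wall spanned by `t \ {e}`: its
coefficient in the expansion `μ` of `v e` over the flipped set is not positive. -/
lemma flip_coefficient_nonpos {v : E → W} {T : Set (Set E)} (huniq : HasUniqueRepresentations v T)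
    {t : Set E} (ht : t ∈ T) {e f : E} (he : e ∈ t) (hf : f ∉ t)
    (ht' : insert f (t \ {e}) ∈ T) {μ : E → ℝ} (hμ : ∀ g ∉ insert f (t \ {e}), μ g = 0)
    (hμe : Fintype.linearCombination ℝ v μ = v e) : μ f ≤ 0 := by
  classical
  by_contra! hpos
  have hef : e ≠ f := fun h => hf (h ▸ he)
  -- Far out along the wall, a point just off the wall would lie in both cones.
  set M := ∑ g, |μ g| with hM
  have hM0 : 0 ≤ M := Finset.sum_nonneg fun g _ => abs_nonneg _
  have hMg : ∀ g, 0 ≤ M + μ g := fun g => by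
    have := Finset.single_le_sum (f := fun g => |μ g|) (fun g _ => abs_nonneg _)
      (Finset.mem_univ g)
    linarith [neg_abs_le (μ g)]
  let w : E → ℝ := fun g => if g ∈ t \ {e} then M else 0
  have hw : ∀ g, g ∉ t \ {e} → w g = 0 := fun g hg => if_neg hg
  have := huniq t ht _ ht' (w + Pi.single e 1) (w + μ) ?_ ?_ ?_ ?_ ?_
  · have h1 := congrFun this e
    have h2 : μ e = 0 := hμ e (by simp [hef])
    simp [h2] at h1
  · intro g hg
    have hge : g ≠ e := fun h => hg (h ▸ he)
    simp [hw g (fun h => hg h.1), hge]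
  · intro g hg
    simp [hw g (fun h => hg (Set.mem_insert_of_mem _ h)), hμ g hg]
  · intro g
    simp only [Pi.zero_apply, Pi.add_apply, w]
    have : (0 : ℝ) ≤ (Pi.single e 1 : E → ℝ) g := by
      rw [Pi.single_apply]; split_ifs <;> norm_num
    split_ifs <;> linarith
  · intro g
    simp only [Pi.zero_apply, Pi.add_apply]
    by_cases hg : g ∈ t \ {e}
    · simpa only [w, if_pos hg] using hMg g
    · rw [hw g hg, zero_add]
      by_cases hgf : g = f
      · rw [hgf]; exact hpos.le
      · exact (hμ g (by simp only [Set.mem_insert_iff, not_or]; exact ⟨hgf, hg⟩)).ge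
  · rw [map_add, map_add, hμe, Fintype.linearCombination_apply_single, one_smul]

/-- Crossing a wall of the cone over `t`: if the coefficients `c + x • γ` are positive on `t`
except that the one at `e` vanishes with negative slope, then for `x'` slightly above `x` the point
lies in the cone of the flip of `t` at `e`. -/
lemma eventually_nonneg_flip {v : E → W} {T : Set (Set E)}
    (hbasis : ∀ t ∈ T, IsCoordinateSet v t) (huniq : HasUniqueRepresentations v T)
    {t : Set E} (ht : t ∈ T) {e f : E} (he : e ∈ t) (hf : f ∉ t)
    (ht' : insert f (t \ {e}) ∈ T) {c γ : E → ℝ} (hc : ∀ g ∉ t, c g = 0) (hγ : ∀ g ∉ t, γ g = 0)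
    {x : ℝ} (hpos : ∀ g ∈ t, g ≠ e → 0 < c g + x * γ g) (hzero : c e + x * γ e = 0)
    (hneg : γ e < 0) :
    ∀ᶠ x' in 𝓝[>] x, ∃ a : E → ℝ, (∀ g ∉ insert f (t \ {e}), a g = 0) ∧ 0 ≤ a ∧
      Fintype.linearCombination ℝ v a = Fintype.linearCombination ℝ v (c + x' • γ) := by
  classical
  have hef : e ≠ f := fun h => hf (h ▸ he)
  obtain ⟨μ, hμ, hμe⟩ := (hbasis _ ht').1 (Pi.single e 1)
  rw [Fintype.linearCombination_apply_single, one_smul] at hμe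
  have hμf := flip_coefficient_nonpos huniq ht he hf ht' hμ hμe
  have hμe0 : μ e = 0 := hμ e (by simp [hef])
  have key : ∀ g ∈ t, g ≠ e →
      ∀ᶠ x' in 𝓝[>] x, 0 < c g + x' * γ g + (c e + x' * γ e) * μ g := by
    intro g hg hge
    have hcont : Continuous fun x' : ℝ => c g + x' * γ g + (c e + x' * γ e) * μ g := by fun_prop
    refine (hcont.tendsto x).eventually_const_lt ?_ |>.filter_mono nhdsWithin_le_nhds
    simpa [hzero] using hpos g hg hge
  have key' : ∀ᶠ x' in 𝓝[>] x, ∀ g, g ∈ t → g ≠ e →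
      0 < c g + x' * γ g + (c e + x' * γ e) * μ g := by
    rw [eventually_all]
    intro g
    by_cases hg : g ∈ t ∧ g ≠ e
    · filter_upwards [key g hg.1 hg.2] with x' h _ _ using h
    · exact Eventually.of_forall fun x' h1 h2 => absurd ⟨h1, h2⟩ hg
  filter_upwards [key', self_mem_nhdsWithin] with x' hx' hgt
  have hce : c e + x' * γ e < 0 := by
    have : x < x' := hgt
    nlinarith
  refine ⟨c + x' • γ + (c e + x' * γ e) • (μ - Pi.single e 1), ?_, ?_, ?_⟩
  · intro g hg
    simp only [Set.mem_insert_iff, not_or] at hg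
    have hμg := hμ g (by simpa using hg)
    by_cases hge : g = e
    · subst hge; simp [hμg]
    · have hgt : g ∉ t := fun h => hg.2 ⟨h, hge⟩
      simp [hc g hgt, hγ g hgt, hμg, hge]
  · intro g
    by_cases hge : g = e
    · subst hge; simp [hμe0]
    · by_cases hgt : g ∈ t
      · simpa [hge] using (hx' g hgt hge).le
      · by_cases hgf : g = f
        · subst hgf
          simpa [hc g hgt, hγ g hgt, hge] using mul_nonneg_of_nonpos_of_nonpos hce.le hμf
        · have hμg := hμ g (by simp [hgf, hgt])
          simp [hc g hgt, hγ g hgt, hμg, hge]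
  · rw [map_add _ (c + x' • γ), map_smul, map_sub, hμe, Fintype.linearCombination_apply_single,
      one_smul, sub_self, smul_zero, add_zero]

/-- **Covering criterion.** If the cones over the members of `T` intersect properly, and each wall
of each of them is either flippable inside `T` or lies on a supporting hyperplane of the cone over
all the vectors `v e`, then the cones over the members of `T` cover the cone over all `v e`. -/
theorem exists_nonneg_representation_of_flips {v : E → W} {T : Set (Set E)} (hT : T.Nonempty)
    (hbasis : ∀ t ∈ T, IsCoordinateSet v t) (huniq : HasUniqueRepresentations v T)
    (hflip : ∀ t ∈ T, ∀ e ∈ t, (∃ f ∉ t, insert f (t \ {e}) ∈ T) ∨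
      ∃ ℓ : W →ₗ[ℝ] ℝ, (∀ g, 0 ≤ ℓ (v g)) ∧ (∀ g ∈ t, g ≠ e → ℓ (v g) = 0) ∧ 0 < ℓ (v e))
    (p : E → ℝ) (hp : 0 ≤ p) :
    ∃ t ∈ T, ∃ a : E → ℝ, (∀ e ∉ t, a e = 0) ∧ 0 ≤ a ∧
      Fintype.linearCombination ℝ v a = Fintype.linearCombination ℝ v p := by
  classical
  obtain ⟨t₀, ht₀⟩ := hT
  -- `coord t g` are the coordinates of `v g` over `t`.
  have hcoord : ∀ t : T, ∀ g : E, ∃ a : E → ℝ, (∀ e ∉ t.1, a e = 0) ∧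
      Fintype.linearCombination ℝ v a = v g := fun t g => by
    simpa using (hbasis t t.2).1 (Pi.single g 1)
  choose coord hcs hcv using hcoord
  let C : T → (E → ℝ) →ₗ[ℝ] (E → ℝ) := fun t => Fintype.linearCombination ℝ (coord t)
  have hC : ∀ t c e, C t c e = ∑ g, c g * coord t g e := fun t c e => by
    simp [C, Fintype.linearCombination_apply]
  have hCs : ∀ t c, ∀ e ∉ t.1, C t c e = 0 := fun t c e he => by
    simp [hC, hcs t _ e he]
  have hCv : ∀ t c, Fintype.linearCombination ℝ v (C t c) = Fintype.linearCombination ℝ v c :=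
    fun t c => by
      simp only [C, Fintype.linearCombination_apply ℝ (coord t), map_sum, map_smul, hcv]
      rw [Fintype.linearCombination_apply]
  have hCeq : ∀ t c (a : E → ℝ), (∀ e ∉ t.1, a e = 0) →
      Fintype.linearCombination ℝ v a = Fintype.linearCombination ℝ v c → C t c = a :=
    fun t c a ha h => (hbasis t t.2).2 _ _ (hCs t c) ha ((hCv t c).trans h.symm)
  -- Starting point `q` in the open cone over `t₀`, such that the half-open segment from `q` to `p`
  -- avoids the faces of codimension two of all the cones.
  have hscal : ∀ x y : ℝ, ∃ u w : ℝ, (u ≠ 0 ∨ w ≠ 0) ∧ u * x = w * y := fun x y => by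
    by_cases h : x = 0 ∧ y = 0
    · exact ⟨1, 0, by simp, by simp [h.1]⟩
    · refine ⟨y, x, ?_, mul_comm _ _⟩
      by_contra! h'
      exact h ⟨h'.2, h'.1⟩
  choose u w huw huw' using hscal
  let ι := {i : T × E × E // i.2.1 ∈ i.1.1 ∧ i.2.2 ∈ i.1.1 ∧ i.2.1 ≠ i.2.2}
  let U : ι → ℝ := fun i => u (C i.1.1 p i.1.2.1) (C i.1.1 p i.1.2.2)
  let V : ι → ℝ := fun i => w (C i.1.1 p i.1.2.1) (C i.1.1 p i.1.2.2)
  let Λ : ι → E → ℝ := fun i g =>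
    U i * coord i.1.1 g i.1.2.1 - V i * coord i.1.1 g i.1.2.2
  have hΛ : ∀ i (c : E → ℝ), ∑ g, c g * Λ i g =
      U i * C i.1.1 c i.1.2.1 - V i * C i.1.1 c i.1.2.2 := fun i c => by
    simp only [Λ, hC, Finset.mul_sum, ← Finset.sum_sub_distrib]
    exact Finset.sum_congr rfl fun g _ => by ring
  obtain ⟨q, hq, hqs, hqne⟩ := exists_pos_forall_ne_zero t₀ Λ (by
    rintro ⟨⟨t, e, e'⟩, he, he', hee⟩
    by_contra! h0
    have hz : ∀ g, Λ ⟨⟨t, e, e'⟩, he, he', hee⟩ g = 0 := fun g => by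
      have h1 := hΛ ⟨⟨t, e, e'⟩, he, he', hee⟩ (Pi.single g 1)
      have h2 := hΛ ⟨⟨t, e, e'⟩, he, he', hee⟩ (coord ⟨t₀, ht₀⟩ g)
      have h3 : C t (coord ⟨t₀, ht₀⟩ g) = C t (Pi.single g 1) :=
        hCeq _ _ _ (hCs _ _) (by rw [hCv, hcv]; simp)
      simp only [h3] at h2
      rw [← h1, Finset.sum_eq_zero] at h2
      · simpa [Pi.single_apply] using h2.symm
      · intro k _
        by_cases hk : k ∈ t₀
        · rw [h0 k hk, mul_zero]
        · rw [hcs _ _ k hk, zero_mul]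
    have hse : ∀ g ∈ t.1, coord t g = Pi.single g 1 := fun g hg =>
      (hbasis t t.2).2 _ _ (hcs t g)
        (fun k hk => Pi.single_eq_of_ne (fun h : k = g => hk (h ▸ hg)) _) (by rw [hcv]; simp)
    have h1 := hz e
    have h2 := hz e'
    simp only [Λ, hse e he, hse e' he', Pi.single_eq_same, Pi.single_eq_of_ne hee,
      Pi.single_eq_of_ne hee.symm, mul_one, mul_zero, sub_zero, zero_sub, neg_eq_zero] at h1 h2
    exact (huw _ _).elim (fun h => h h1) (fun h => h h2))
  have hq0 : 0 ≤ q := fun e => by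
    by_cases he : e ∈ t₀
    · exact (hq e he).le
    · exact (hqs e he).ge
  -- The set of parameters at which the segment is covered is closed and grows to the right.
  let S : Set ℝ := {x | ∃ t : T, 0 ≤ C t q + x • (C t p - C t q)}
  have hSmem : ∀ x, x ∈ S ↔ ∃ t ∈ T, ∃ a : E → ℝ, (∀ e ∉ t, a e = 0) ∧ 0 ≤ a ∧
      Fintype.linearCombination ℝ v a = Fintype.linearCombination ℝ v (q + x • (p - q)) := by
    intro x
    constructor
    · rintro ⟨t, ht⟩
      rw [← map_sub, ← map_smul, ← map_add] at ht
      exact ⟨t, t.2, _, hCs _ _, ht, hCv _ _⟩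
    · rintro ⟨t, ht, a, has, ha, hae⟩
      refine ⟨⟨t, ht⟩, ?_⟩
      rw [← map_sub, ← map_smul, ← map_add, hCeq _ _ a has hae]
      exact ha
  have hSclosed : IsClosed S := by
    have : S = ⋃ t : T, {x : ℝ | 0 ≤ C t q + x • (C t p - C t q)} := by
      ext x; simp [S]
    rw [this]
    exact isClosed_iUnion_of_finite fun t => isClosed_le continuous_const (by fun_prop)
  suffices h : Set.Icc (0 : ℝ) 1 ⊆ S by
    simpa using (hSmem 1).1 (h ⟨zero_le_one, le_rfl⟩)
  refine (hSclosed.inter isClosed_Icc).Icc_subset_of_forall_exists_gt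
    ((hSmem 0).2 ⟨t₀, ht₀, q, hqs, hq0, by simp⟩) ?_
  rintro x ⟨⟨t, hxt⟩, hx0, hx1⟩ y hy
  suffices h : ∀ᶠ x' in 𝓝[>] x, x' ∈ S from (h.and (Ioc_mem_nhdsGT hy)).exists
  set c := C t q with hc
  set γ := C t p - C t q with hγ
  have hval : ∀ e, 0 ≤ c e + x * γ e := fun e => hxt e
  have hone : ∀ e ∈ t.1, ∀ e' ∈ t.1, e ≠ e' → c e + x * γ e = 0 → c e' + x * γ e' = 0 → False := by
    intro e he e' he' hee h1 h2
    apply hqne ⟨⟨t, e, e'⟩, he, he', hee⟩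
    have h3 : U ⟨⟨t, e, e'⟩, he, he', hee⟩ * C t p e = V ⟨⟨t, e, e'⟩, he, he', hee⟩ * C t p e' :=
      huw' _ _
    rw [hΛ]
    simp only [hγ, hc, Pi.sub_apply] at h1 h2 ⊢
    have hx : (1 : ℝ) - x ≠ 0 := by linarith
    apply mul_left_cancel₀ hx
    linear_combination U ⟨⟨t, e, e'⟩, he, he', hee⟩ * h1 - V ⟨⟨t, e, e'⟩, he, he', hee⟩ * h2 - x * h3
  by_cases hex : ∃ e ∈ t.1, c e + x * γ e = 0 ∧ γ e < 0
  · obtain ⟨e, he, hzero, hneg⟩ := hex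
    have hpos : ∀ g ∈ t.1, g ≠ e → 0 < c g + x * γ g := fun g hg hge =>
      (hval g).lt_of_ne fun h => hone g hg e he hge h.symm hzero
    rcases hflip t t.2 e he with ⟨f, hf, ht'⟩ | ⟨ℓ, hℓ, hℓt, hℓe⟩
    · filter_upwards [eventually_nonneg_flip hbasis huniq t.2 he hf ht' (hCs t q)
        (fun g hg => by simp [hγ, hCs t _ g hg]) hpos hzero hneg] with x' ⟨a, has, ha, hav⟩
      refine (hSmem x').2 ⟨_, ht', a, has, ha, hav.trans ?_⟩
      rw [hγ, ← map_sub, ← map_smul, ← map_add, hCv]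
    · -- The form `ℓ` is positive before the end of the segment, but vanishes at `x`.
      exfalso
      have hℓc : ∀ a : E → ℝ, ℓ (Fintype.linearCombination ℝ v a) = ∑ g, a g * ℓ (v g) :=
        fun a => by simp [Fintype.linearCombination_apply]
      have hqpos : 0 < ℓ (Fintype.linearCombination ℝ v q) := by
        rw [hℓc]
        refine (Finset.sum_nonneg fun g _ => mul_nonneg (hq0 g) (hℓ g)).lt_of_ne' fun h0 => ?_
        rw [Finset.sum_eq_zero_iff_of_nonneg fun g _ => mul_nonneg (hq0 g) (hℓ g)] at h0
        have h1 : ℓ (v e) = 0 := by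
          rw [← hcv ⟨t₀, ht₀⟩ e, hℓc]
          refine Finset.sum_eq_zero fun g _ => ?_
          by_cases hg : g ∈ t₀
          · have := h0 g (Finset.mem_univ g)
            rw [(mul_eq_zero.1 this).resolve_left (hq g hg).ne', mul_zero]
          · rw [hcs _ _ g hg, zero_mul]
        exact hℓe.ne' h1
      have hppos : 0 ≤ ℓ (Fintype.linearCombination ℝ v p) := by
        rw [hℓc]
        exact Finset.sum_nonneg fun g _ => mul_nonneg (hp g) (hℓ g)
      have hzero' : ℓ (Fintype.linearCombination ℝ v (c + x • γ)) = 0 := by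
        rw [hℓc]
        refine Finset.sum_eq_zero fun g _ => ?_
        by_cases hg : g ∈ t.1
        · by_cases hge : g = e
          · subst hge; simp [hzero]
          · rw [hℓt g hg hge, mul_zero]
        · simp [hc, hγ, hCs t _ g hg]
      rw [hc, hγ, ← map_sub, ← map_smul, ← map_add, hCv, map_add, map_smul, map_sub, map_add,
        map_smul, map_sub, smul_eq_mul] at hzero'
      nlinarith
  · push Not at hex
    have : ∀ᶠ x' in 𝓝[>] x, ∀ e, 0 ≤ c e + x' * γ e := by
      rw [eventually_all]
      intro e
      by_cases he : e ∈ t.1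
      · rcases (hval e).lt_or_eq with hlt | heq
        · have hcont : Continuous fun x' : ℝ => c e + x' * γ e := by fun_prop
          filter_upwards [((hcont.tendsto x).eventually_const_lt hlt).filter_mono
            nhdsWithin_le_nhds] with x' h using h.le
        · filter_upwards [self_mem_nhdsWithin] with x' hx'
          have h1 := hex e he heq.symm
          have h2 : x < x' := hx'
          nlinarith
      · exact Eventually.of_forall fun x' => by simp [hc, hγ, hCs t _ e he]
    filter_upwards [this] with x' hx'
    exact ⟨t, fun e => hx' e⟩

lemma exists_representation_of_mem_span {v : E → W} {A : Set E} {z : W}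
    (hz : z ∈ Submodule.span ℝ (v '' A)) :
    ∃ a : E → ℝ, (∀ e ∉ A, a e = 0) ∧ Fintype.linearCombination ℝ v a = z := by
  classical
  induction hz using Submodule.span_induction with
  | mem z hz =>
    obtain ⟨e, he, rfl⟩ := hz
    exact ⟨Pi.single e 1, fun g hg => Pi.single_eq_of_ne (fun h : g = e => hg (h ▸ he)) _, by simp⟩
  | zero => exact ⟨0, fun _ _ => rfl, map_zero _⟩
  | add x y _ _ hx hy =>
    obtain ⟨a, ha, rfl⟩ := hx
    obtain ⟨b, hb, rfl⟩ := hy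
    exact ⟨a + b, fun e he => by simp [ha e he, hb e he], map_add _ _ _⟩
  | smul r x _ hx =>
    obtain ⟨a, ha, rfl⟩ := hx
    exact ⟨r • a, fun e he => by simp [ha e he], map_smul _ _ _⟩

lemma isCoordinateSet_of_mem_span {v : E → W} {A : Set E}
    (hspan : ∀ e, v e ∈ Submodule.span ℝ (v '' A))
    (huniq : ∀ a b : E → ℝ, (∀ e ∉ A, a e = 0) → (∀ e ∉ A, b e = 0) →
      Fintype.linearCombination ℝ v a = Fintype.linearCombination ℝ v b → a = b) :
    IsCoordinateSet v A := by
  refine ⟨fun c => exists_representation_of_mem_span ?_, huniq⟩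
  rw [Fintype.linearCombination_apply]
  exact Submodule.sum_mem _ fun e _ => Submodule.smul_mem _ _ (hspan e)

lemma sum_coe_of_support {M : Type*} [AddCommMonoid M] {A : Set E} [Fintype A] {F : E → M}
    (hF : ∀ e ∉ A, F e = 0) : ∑ e : A, F e = ∑ e, F e := by
  classical
  rw [← Finset.sum_filter_of_ne (p := (· ∈ A)) fun e _ h => by_contra fun h' => h (hF e h')]
  exact (Finset.sum_subtype _ (by simp) F).symm

lemma mem_convexHull_image_iff {v : E → W} {A : Set E} {x : W} :
    x ∈ convexHull ℝ (v '' A) ↔ ∃ a : E → ℝ, 0 ≤ a ∧ (∀ e ∉ A, a e = 0) ∧ ∑ e, a e = 1 ∧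
      Fintype.linearCombination ℝ v a = x := by
  classical
  constructor
  · intro hx
    refine convexHull_min (s := v '' A) (t := {x | ∃ a : E → ℝ, 0 ≤ a ∧ (∀ e ∉ A, a e = 0) ∧
      ∑ e, a e = 1 ∧ Fintype.linearCombination ℝ v a = x}) ?_ ?_ hx
    · rintro _ ⟨e, he, rfl⟩
      refine ⟨Pi.single e 1, ?_, ?_, ?_, by simp⟩
      · exact Pi.single_nonneg.2 zero_le_one
      · exact fun g hg => Pi.single_eq_of_ne (fun h : g = e => hg (h ▸ he)) _
      · simp
    · rintro _ ⟨a, ha, has, ha1, rfl⟩ _ ⟨b, hb, hbs, hb1, rfl⟩ α β hα hβ hαβ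
      refine ⟨α • a + β • b, ?_, fun e he => by simp [has e he, hbs e he], ?_, by simp⟩
      · exact add_nonneg (smul_nonneg hα ha) (smul_nonneg hβ hb)
      · simp [Finset.sum_add_distrib, ← Finset.mul_sum, ha1, hb1, hαβ]
  · rintro ⟨a, ha, has, ha1, rfl⟩
    rw [Fintype.linearCombination_apply, ← Finset.sum_filter_of_ne (p := fun e => a e ≠ 0)
      fun e _ h h' => h (by rw [h', zero_smul])]
    refine (convex_convexHull ℝ _).sum_mem (fun e _ => ha e) ?_ fun e he => ?_
    · rw [← ha1, Finset.sum_filter_of_ne fun e _ h => h]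
    · exact subset_convexHull ℝ _ ⟨e, by_contra fun h => (Finset.mem_filter.1 he).2 (has e h), rfl⟩

end Covering

/-! ### Alternating cycles and matrices with vanishing row and column sums -/

section AlternatingCycles

open SimpleGraph Function

lemma exists_walk_iterate {V : Type*} {G : SimpleGraph V} (f : V → V) (k : ℕ) (x : V)
    (h : ∀ i < k, G.Adj (f^[i] x) (f^[i + 1] x)) :
    ∃ p : G.Walk x (f^[k] x), p.length = k ∧ ∀ i ≤ k, p.getVert i = f^[i] x := by
  induction k generalizing x with
  | zero => exact ⟨Walk.nil, rfl, fun i hi => by simp [Nat.le_zero.1 hi]⟩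
  | succ k ih =>
    obtain ⟨p, hp, hpv⟩ := ih (f x) fun i hi => by
      simpa only [← iterate_succ_apply] using h (i + 1) (by omega)
    have key : ∃ q : G.Walk x (f^[k] (f x)), q.length = k + 1 ∧
        ∀ i ≤ k + 1, q.getVert i = f^[i] x := by
      have h0 : G.Adj x (f x) := h 0 k.succ_pos
      refine ⟨Walk.cons h0 p, by rw [Walk.length_cons, hp], fun i hi => ?_⟩
      cases i with
      | zero => simp
      | succ i => rw [Walk.getVert_cons_succ, hpv i (by omega), iterate_succ_apply]
    exact key

/-- On a finite vertex set, following an asymmetric relation in which every successor has a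
successor leads into a cycle. If every step of the relation meets `B`, the cycle can be started
in `B`. -/
lemma exists_isCycle_of_successors {V : Type*} [Finite V] {G : SimpleGraph V} {R : V → V → Prop}
    (hG : ∀ v w, R v w → G.Adj v w) (hsucc : ∀ v w, R v w → ∃ u, R w u)
    (hasymm : ∀ v w, R v w → ¬ R w v) (B : Set V) (hB : ∀ v w, R v w → v ∈ B ∨ w ∈ B)
    {v₀ w₀ : V} (h₀ : R v₀ w₀) :
    ∃ v ∈ B, ∃ p : G.Walk v v, p.IsCycle ∧
      ∀ k < p.length, R (p.getVert k) (p.getVert (k + 1)) := by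
  classical
  have hf : ∃ f : V → V, ∀ v, (∃ w, R v w) → R v (f v) := by
    refine ⟨fun v => if h : ∃ w, R v w then h.choose else v, fun v h => ?_⟩
    simpa only [dif_pos h] using h.choose_spec
  obtain ⟨f, hf⟩ := hf
  have hit : ∀ x, (∃ w, R x w) → ∀ i, R (f^[i] x) (f^[i + 1] x) := by
    intro x hx i
    induction i with
    | zero => exact hf x hx
    | succ i ih =>
      have := hf _ (hsucc _ _ ih)
      rwa [← iterate_succ_apply' f (i + 1)] at this
  obtain ⟨a, b, hne, hab⟩ := Finite.exists_ne_map_eq_of_infinite fun i : ℕ => f^[i] v₀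
  obtain ⟨x, hx, hxp⟩ : ∃ x, (∃ w, R x w) ∧ x ∈ periodicPts f := by
    wlog hlt : a < b generalizing a b
    · exact this b a hne.symm hab.symm (by omega)
    refine ⟨f^[a] v₀, ⟨_, hit v₀ ⟨_, h₀⟩ a⟩, mk_mem_periodicPts (Nat.sub_pos_of_lt hlt) ?_⟩
    rw [IsPeriodicPt, IsFixedPt, ← iterate_add_apply, Nat.sub_add_cancel hlt.le]
    exact hab.symm
  obtain ⟨y, hyB, hy, hyp⟩ : ∃ y ∈ B, (∃ w, R y w) ∧ y ∈ periodicPts f := by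
    rcases hB x (f x) (hf x hx) with h | h
    · exact ⟨x, h, hx, hxp⟩
    · refine ⟨f x, h, ⟨_, hit x hx 1⟩, ?_⟩
      obtain ⟨m, hm, hmx⟩ := hxp
      exact mk_mem_periodicPts hm (show f^[m] (f x) = f x by rw [← iterate_succ_apply, iterate_succ_apply', hmx.eq])
  obtain ⟨k, hk⟩ : ∃ k, k = minimalPeriod f y := ⟨_, rfl⟩
  obtain ⟨p, hp, hpv⟩ := exists_walk_iterate (G := G) f k y fun i _ => hG _ _ (hit y hy i)
  have hper : f^[k] y = y := hk ▸ isPeriodicPt_minimalPeriod f y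
  have hkpos : 0 < k := hk ▸ minimalPeriod_pos_of_mem_periodicPts hyp
  have hk1 : k ≠ 1 := fun h => by
    rw [h] at hper
    exact (hG _ _ (hit y hy 0)).ne hper.symm
  have hk2 : k ≠ 2 := fun h => by
    rw [h] at hper
    have := hit y hy 1
    rw [hper] at this
    exact hasymm _ _ (hit y hy 0) this
  have hlen : (p.copy rfl hper).length = k := by rw [Walk.length_copy, hp]
  have hvert : ∀ i ≤ k, (p.copy rfl hper).getVert i = f^[i] y := fun i hi => by
    rw [Walk.getVert_copy, hpv i hi]
  refine ⟨y, hyB, p.copy rfl hper, ?_, fun i hi => ?_⟩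
  · rw [Walk.isCycle_iff_isPath_tail_and_le_length]
    refine ⟨?_, by omega⟩
    rw [← Walk.IsPath.getVert_injOn_iff]
    have htail : ((p.copy rfl hper).tail).length = k - 1 := by simp [hp]
    intro i hi j hj hij
    simp only [Set.mem_ofPred_eq, htail] at hi hj
    rw [Walk.getVert_tail, Walk.getVert_tail, hvert _ (by omega), hvert _ (by omega)] at hij
    have hinj := iterate_injOn_Iio_minimalPeriod (f := f) (x := f y)
    rw [minimalPeriod_apply hyp, ← hk] at hinj
    exact hinj (Set.mem_Iio.2 (by omega)) (Set.mem_Iio.2 (by omega)) hij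
  · rw [hlen] at hi
    rw [hvert i hi.le, hvert (i + 1) hi]
    exact hit y hy i

variable {n d : ℕ}

/-- The vertex `v_i × w_j` of the product of simplices, indexed by the edge `(i, j)`. -/
def edgeVector (e : Fin n × Fin d) : (Fin n → ℝ) × (Fin d → ℝ) :=
  productVertex e.1 e.2

/-- The pairs `(i, j)` for which `v_i w_j` is an edge of `t`. -/
def edgePairs (t : (bipartiteK n d).Subgraph) : Set (Fin n × Fin d) :=
  {e | t.Adj (Sum.inl e.1) (Sum.inr e.2)}

/-- The row and column sums of an `n × d` matrix; equivalently, the linear combination of the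
vertices `v_i × w_j` with the entries of the matrix as coefficients. -/
noncomputable abbrev marginals :
    (Fin n × Fin d → ℝ) →ₗ[ℝ] (Fin n → ℝ) × (Fin d → ℝ) :=
  Fintype.linearCombination ℝ edgeVector

lemma marginals_single (e : Fin n × Fin d) : marginals (Pi.single e 1) = edgeVector e := by
  simp

lemma marginals_fst (a : Fin n × Fin d → ℝ) (i : Fin n) :
    (marginals a).1 i = ∑ j, a (i, j) := by
  simp only [marginals, Fintype.linearCombination_apply, edgeVector, productVertex, Prod.fst_sum,
    Finset.sum_apply, Prod.smul_fst, Pi.smul_apply, smul_eq_mul, Pi.single_apply,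
    Fintype.sum_prod_type, mul_ite, mul_one, mul_zero]
  rw [Finset.sum_comm]
  simp

lemma marginals_snd (a : Fin n × Fin d → ℝ) (j : Fin d) :
    (marginals a).2 j = ∑ i, a (i, j) := by
  simp only [marginals, Fintype.linearCombination_apply, edgeVector, productVertex, Prod.snd_sum,
    Finset.sum_apply, Prod.smul_snd, Pi.smul_apply, smul_eq_mul, Pi.single_apply,
    Fintype.sum_prod_type, mul_ite, mul_one, mul_zero]
  simp

/-- A nonzero matrix with vanishing row and column sums has an alternating cycle in its support:
leave each `v_i` along a positive entry and each `w_j` along a negative entry. -/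
lemma exists_alternating_cycle {t s : (bipartiteK n d).Subgraph} {c : Fin n × Fin d → ℝ}
    (hc : marginals c = 0) (hne : c ≠ 0) (ht : ∀ e, 0 < c e → e ∈ edgePairs t)
    (hs : ∀ e, c e < 0 → e ∈ edgePairs s) :
    ∃ (v : Fin n ⊕ Fin d) (p : (bipartiteK n d).Walk v v),
      p.IsCycle ∧ AlternatesBetween p t s := by
  let R : Fin n ⊕ Fin d → Fin n ⊕ Fin d → Prop := fun x y =>
    (∃ i j, x = Sum.inl i ∧ y = Sum.inr j ∧ 0 < c (i, j)) ∨
    (∃ i j, x = Sum.inr j ∧ y = Sum.inl i ∧ c (i, j) < 0)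
  have hrow : ∀ i j, c (i, j) < 0 → ∃ j', 0 < c (i, j') := by
    intro i j hij
    by_contra! h
    have h0 : ∑ j, c (i, j) = 0 := by rw [← marginals_fst, hc]; rfl
    rw [Finset.sum_eq_zero_iff_of_nonpos fun j _ => h j] at h0
    exact hij.ne (h0 j (Finset.mem_univ j))
  have hcol : ∀ i j, 0 < c (i, j) → ∃ i', c (i', j) < 0 := by
    intro i j hij
    by_contra! h
    have h0 : ∑ i, c (i, j) = 0 := by rw [← marginals_snd, hc]; rfl
    rw [Finset.sum_eq_zero_iff_of_nonneg fun i _ => h i] at h0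
    exact hij.ne' (h0 i (Finset.mem_univ i))
  have hstart : ∃ x y, R x y := by
    obtain ⟨⟨i, j⟩, hij⟩ := Function.ne_iff.1 hne
    rcases lt_or_gt_of_ne hij with h | h
    · exact ⟨_, _, Or.inr ⟨i, j, rfl, rfl, h⟩⟩
    · exact ⟨_, _, Or.inl ⟨i, j, rfl, rfl, h⟩⟩
  obtain ⟨x, y, hxy⟩ := hstart
  obtain ⟨v, ⟨i₀, hv⟩, p, hp, hR⟩ := exists_isCycle_of_successors (G := bipartiteK n d) (R := R)
    (by rintro _ _ (⟨i, j, rfl, rfl, h⟩ | ⟨i, j, rfl, rfl, h⟩) <;> simp)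
    (by
      rintro _ _ (⟨i, j, rfl, rfl, h⟩ | ⟨i, j, rfl, rfl, h⟩)
      · obtain ⟨i', h'⟩ := hcol i j h
        exact ⟨_, Or.inr ⟨i', j, rfl, rfl, h'⟩⟩
      · obtain ⟨j', h'⟩ := hrow i j h
        exact ⟨_, Or.inl ⟨i, j', rfl, rfl, h'⟩⟩)
    (by
      rintro _ _ (⟨i, j, rfl, rfl, h⟩ | ⟨i, j, rfl, rfl, h⟩) <;>
      rintro (⟨i', j', h1, h2, h'⟩ | ⟨i', j', h1, h2, h'⟩) <;>
      simp_all <;> linarith)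
    (Set.range Sum.inl)
    (by rintro _ _ (⟨i, j, rfl, rfl, h⟩ | ⟨i, j, rfl, rfl, h⟩) <;> simp)
    hxy
  refine ⟨v, p, hp, ?_⟩
  have hside : ∀ k ≤ p.length, (Even k → ∃ i, p.getVert k = Sum.inl i) ∧
      (Odd k → ∃ j, p.getVert k = Sum.inr j) := by
    intro k
    induction k with
    | zero => exact fun _ => ⟨fun _ => ⟨i₀, by simp [hv]⟩, fun h => by simp at h⟩
    | succ k ih =>
      intro hk
      have h1 := ih (by omega)
      have h2 := hR k (by omega)
      constructor
      · intro he
        obtain ⟨j, hj⟩ := h1.2 (by rcases he with ⟨m, hm⟩; exact ⟨m - 1, by omega⟩)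
        rw [hj] at h2
        rcases h2 with ⟨i', j', e1, _⟩ | ⟨i', j', _, e2, _⟩
        · simp at e1
        · exact ⟨i', e2⟩
      · intro ho
        obtain ⟨j, hj⟩ := h1.1 (by rcases ho with ⟨m, hm⟩; exact ⟨m, by omega⟩)
        rw [hj] at h2
        rcases h2 with ⟨i', j', _, e2, _⟩ | ⟨i', j', e1, _⟩
        · exact ⟨j', e2⟩
        · simp at e1
  intro k hk
  constructor
  · intro he
    obtain ⟨i, hi⟩ := (hside k hk.le).1 he
    rcases hR k hk with ⟨i', j', e1, e2, h⟩ | ⟨i', j', e1, e2, h⟩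
    · rw [e1, e2]; exact ht _ h
    · simp [hi] at e1
  · intro ho
    obtain ⟨i, hi⟩ := (hside k hk.le).2 ho
    rcases hR k hk with ⟨i', j', e1, e2, h⟩ | ⟨i', j', e1, e2, h⟩
    · simp [hi] at e1
    · rw [e1, e2]; exact (hs _ h).symm

/-- The even and the odd edges of an alternating cycle have the same sum, so some point has two
different representations, over `t` and over `s`. -/
lemma exists_ne_of_alternating_cycle {t s : (bipartiteK n d).Subgraph} {v : Fin n ⊕ Fin d}
    {p : (bipartiteK n d).Walk v v} (hp : p.IsCycle) (halt : AlternatesBetween p t s) :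
    ∃ a b : Fin n × Fin d → ℝ, 0 ≤ a ∧ 0 ≤ b ∧ (∀ e ∉ edgePairs t, a e = 0) ∧
      (∀ e ∉ edgePairs s, b e = 0) ∧ marginals a = marginals b ∧ a ≠ b := by
  classical
  let ind : Fin n ⊕ Fin d → Fin n ⊕ Fin d → Fin n × Fin d → ℝ := fun x y e =>
    if s(Sum.inl e.1, Sum.inr e.2) = s(x, y) then 1 else 0
  let pt : Fin n ⊕ Fin d → (Fin n → ℝ) × (Fin d → ℝ) :=
    Sum.elim (fun i => (Pi.single i 1, 0)) (fun j => (0, Pi.single j 1))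
  have hind0 : ∀ x y e, 0 ≤ ind x y e := fun x y e => by
    simp only [ind]; split_ifs <;> norm_num
  have hsymm : ∀ x y, ind x y = ind y x := fun x y => by
    ext e; simp only [ind, Sym2.eq_swap (a := x)]
  have hpt' : ∀ i j, marginals (ind (Sum.inl i) (Sum.inr j)) = pt (Sum.inl i) + pt (Sum.inr j) := by
    intro i j
    have : ind (Sum.inl i) (Sum.inr j) = Pi.single (i, j) 1 := by
      ext ⟨i', j'⟩
      simp [ind, Pi.single_apply]
    rw [this, marginals_single]
    simp [edgeVector, productVertex, pt]
  have hpt : ∀ x y, (bipartiteK n d).Adj x y → marginals (ind x y) = pt x + pt y := by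
    rintro (i | j) (i' | j') h
    · simp at h
    · exact hpt' i j'
    · rw [hsymm, hpt' i' j, add_comm]
    · simp at h
  have hmem : ∀ (r : (bipartiteK n d).Subgraph) x y e, r.Adj x y → e ∉ edgePairs r →
      ind x y e = 0 := by
    intro r x y e hxy he
    refine if_neg fun h => he ?_
    have : s(Sum.inl e.1, Sum.inr e.2) ∈ r.edgeSet := by rw [h]; exact hxy
    exact this
  set L := p.length with hL
  have hLeven : Even L := by
    rw [(CompleteBipartiteGraph.bicoloring (Fin n) (Fin d)).even_length_iff_congr p]
  have hL3 : 3 ≤ L := hp.three_le_length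
  let w : ℕ → Fin n × Fin d → ℝ := fun k => ind (p.getVert k) (p.getVert (k + 1))
  refine ⟨∑ k ∈ Finset.range L with Even k, w k, ∑ k ∈ Finset.range L with ¬ Even k, w k,
    ?_, ?_, ?_, ?_, ?_, ?_⟩
  · exact Finset.sum_nonneg fun k _ e => hind0 _ _ _
  · exact Finset.sum_nonneg fun k _ e => hind0 _ _ _
  · intro e he
    rw [Finset.sum_apply]
    refine Finset.sum_eq_zero fun k hk => ?_
    rw [Finset.mem_filter, Finset.mem_range] at hk
    exact hmem t _ _ e ((halt k hk.1).1 hk.2) he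
  · intro e he
    rw [Finset.sum_apply]
    refine Finset.sum_eq_zero fun k hk => ?_
    rw [Finset.mem_filter, Finset.mem_range] at hk
    exact hmem s _ _ e ((halt k hk.1).2 (Nat.not_even_iff_odd.1 hk.2)) he
  · -- The alternating sum of the edge vectors telescopes along the closed walk of even length.
    rw [← sub_eq_zero, ← map_sub, Finset.sum_filter, Finset.sum_filter, ← Finset.sum_sub_distrib,
      map_sum]
    let ε : ℕ → (Fin n → ℝ) × (Fin d → ℝ) := fun k => (-1 : ℝ) ^ k • pt (p.getVert k)
    have : ∀ k ∈ Finset.range L, marginals ((if Even k then w k else 0) -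
        (if ¬ Even k then w k else 0)) = ε k - ε (k + 1) := by
      intro k hk
      have hadj := p.adj_getVert_succ (Finset.mem_range.1 hk)
      by_cases he : Even k
      · simp [he, w, hpt _ _ hadj, ε, pow_succ, he.neg_one_pow]
      · have ho := Nat.not_even_iff_odd.1 he
        simp only [he, if_false, not_false_eq_true, if_true, zero_sub, map_neg, w, hpt _ _ hadj, ε,
          pow_succ, ho.neg_one_pow, neg_smul, one_smul, mul_neg, mul_one, neg_neg]
        abel
    rw [Finset.sum_congr rfl this, Finset.sum_range_sub']
    have hend : p.getVert L = v := by rw [hL, Walk.getVert_length]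
    simp only [ε, hend, hLeven.neg_one_pow, Walk.getVert_zero, pow_zero, sub_self]
  · -- The first edge of the cycle is even and is not repeated.
    obtain ⟨e, he⟩ : ∃ e : Fin n × Fin d,
        s(Sum.inl e.1, Sum.inr e.2) = s(p.getVert 0, p.getVert 1) := by
      have hadj := p.adj_getVert_succ (i := 0) (by omega)
      revert hadj
      rcases p.getVert 0 with i | j <;> rcases p.getVert (0 + 1) with i' | j' <;> intro h
      · simp at h
      · exact ⟨(i, j'), rfl⟩
      · exact ⟨(i', j), Sym2.eq_swap⟩
      · simp at h
    have hodd : (∑ k ∈ Finset.range L with ¬ Even k, w k) e = 0 := by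
      rw [Finset.sum_apply]
      refine Finset.sum_eq_zero fun k hk => if_neg fun h => ?_
      rw [Finset.mem_filter, Finset.mem_range, Nat.not_even_iff_odd] at hk
      have hinj : ∀ i ≤ L - 1, ∀ j ≤ L - 1, p.getVert i = p.getVert j → i = j :=
        fun i hi j hj hij => hp.getVert_injOn' hi hj hij
      rw [he, Sym2.eq_iff] at h
      rcases h with ⟨h, -⟩ | ⟨h, h'⟩
      · have := hinj 0 (by omega) k (by omega) h
        subst this
        exact absurd hk.2 (by decide)
      · have := hinj 1 (by omega) k (by omega) h'
        subst this
        exact absurd (hinj 0 (by omega) 2 (by omega) h) (by decide)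
    have heven : 1 ≤ (∑ k ∈ Finset.range L with Even k, w k) e := by
      rw [Finset.sum_apply]
      have h1 : w 0 e = 1 := if_pos he
      rw [← h1]
      exact Finset.single_le_sum (f := fun k => w k e) (fun k _ => hind0 _ _ _)
        (Finset.mem_filter.2 ⟨Finset.mem_range.2 (by omega), Even.zero⟩)
    intro hab
    rw [hab, hodd] at heven
    exact absurd heven (by norm_num)

end AlternatingCycles

/-! ### Spanning trees -/

section Trees

open SimpleGraph

variable {n d : ℕ}

lemma edgeVector_injective : Function.Injective (edgeVector (n := n) (d := d)) := by
  rintro ⟨i, j⟩ ⟨i', j'⟩ h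
  simp only [edgeVector, productVertex, Prod.mk.injEq] at h
  have h1 := congrFun h.1 i
  have h2 := congrFun h.2 j
  simp only [Pi.single_eq_same, Pi.single_apply] at h1 h2
  ext1
  · exact by_contra fun hne => by simp [hne] at h1
  · exact by_contra fun hne => by simp [hne] at h2

lemma isSpanningTree_iff_spanningCoe {t : (bipartiteK n d).Subgraph} :
    IsSpanningTree t ↔ t.IsSpanning ∧ t.spanningCoe.IsTree :=
  and_congr_right fun h => (Iso.isTree_iff (t.spanningCoeEquivCoeOfSpanning h)).symm

/-- Along a walk in `t`, the signed unit vectors `(e_i, 0)` of `v_i` and `(0, -e_j)` of `w_j` change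
by multiples of the edge vectors of `t`. -/
lemma edgeVector_mem_span_of_connected {t : (bipartiteK n d).Subgraph}
    (h : t.spanningCoe.Connected) (e : Fin n × Fin d) :
    edgeVector e ∈ Submodule.span ℝ (edgeVector '' edgePairs t) := by
  let δ : Fin n ⊕ Fin d → (Fin n → ℝ) × (Fin d → ℝ) :=
    Sum.elim (fun i => (Pi.single i 1, 0)) (fun j => (0, -Pi.single j 1))
  have hδ : ∀ i j, δ (Sum.inl i) - δ (Sum.inr j) = edgeVector (i, j) := fun i j => by
    simp [δ, edgeVector, productVertex]
  have hadj : ∀ x y, t.Adj x y →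
      δ x - δ y ∈ Submodule.span ℝ (edgeVector '' edgePairs t) := by
    rintro (i | j) (i' | j') hxy
    · simpa using hxy.adj_sub
    · rw [hδ]
      exact Submodule.subset_span ⟨(i, j'), hxy, rfl⟩
    · rw [← neg_sub, hδ]
      exact Submodule.neg_mem _ (Submodule.subset_span ⟨(i', j), hxy.symm, rfl⟩)
    · simpa using hxy.adj_sub
  have hwalk : ∀ x y, t.spanningCoe.Walk x y →
      δ x - δ y ∈ Submodule.span ℝ (edgeVector '' edgePairs t) := by
    intro x y p
    induction p with
    | nil => simp
    | cons hxy _ ih =>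
      rw [← sub_add_sub_cancel]
      exact Submodule.add_mem _ (hadj _ _ hxy) ih
  obtain ⟨p⟩ := h.preconnected (Sum.inl e.1) (Sum.inr e.2)
  simpa only [hδ] using hwalk _ _ p

/-- A subgraph of `K_{n,d}` is a spanning tree exactly when its edge vectors form a basis of the
span of all the edge vectors. -/
theorem isSpanningTree_iff_isCoordinateSet (hn : 1 ≤ n) (hd : 1 ≤ d)
    {t : (bipartiteK n d).Subgraph} :
    IsSpanningTree t ↔ IsCoordinateSet edgeVector (edgePairs t) := by
  rw [isSpanningTree_iff_spanningCoe]
  constructor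
  · rintro ⟨-, htree⟩
    refine isCoordinateSet_of_mem_span (edgeVector_mem_span_of_connected htree.connected)
      fun a b ha hb hab => ?_
    by_contra hne
    have hsupp : ∀ e, (a - b) e ≠ 0 → e ∈ edgePairs t := fun e he => by
      by_contra h
      simp [ha e h, hb e h] at he
    obtain ⟨v, p, hp, halt⟩ := exists_alternating_cycle (t := t) (s := t) (c := a - b)
      (by rw [map_sub, sub_eq_zero]; exact hab) (sub_ne_zero.2 hne)
      (fun e he => hsupp e he.ne') (fun e he => hsupp e he.ne)
    have hedges : ∀ e ∈ p.edges, e ∈ t.spanningCoe.edgeSet := by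
      intro e
      induction e with | _ x y
      rw [Walk.mk_mem_edges_iff_exists]
      rintro ⟨k, hk, he⟩
      rw [← he, SimpleGraph.mem_edgeSet, Subgraph.spanningCoe_adj]
      rcases Nat.even_or_odd k with h | h
      · exact (halt k hk).1 h
      · exact (halt k hk).2 h
    exact htree.isAcyclic _ (hp.transfer hedges)
  · rintro ⟨hex, huniq⟩
    have hacyc : t.spanningCoe.IsAcyclic := by
      intro v p hp
      have hp' : (p.mapLe t.spanningCoe_le).IsCycle := (Walk.isCycle_mapLe _).2 hp
      obtain ⟨a, b, -, -, ha, hb, hab, hne⟩ := exists_ne_of_alternating_cycle (t := t) (s := t) hp'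
        (fun k hk => by
          have hk' : k < p.length := by simpa using hk
          have : t.Adj ((p.mapLe t.spanningCoe_le).getVert k)
              ((p.mapLe t.spanningCoe_le).getVert (k + 1)) := by
            simpa [Walk.mapLe, Walk.getVert_map] using p.adj_getVert_succ hk'
          exact ⟨fun _ => this, fun _ => this⟩)
      exact hne (huniq a b ha hb hab)
    have hpre : t.spanningCoe.Preconnected := by
      -- Compare the coordinates belonging to a component: their signed sum vanishes on the edge
      -- vectors of `t`, hence on all edge vectors.
      classical
      intro x
      let A : Set (Fin n ⊕ Fin d) := {y | t.spanningCoe.Reachable x y}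
      let χ : Fin n ⊕ Fin d → ℝ := A.indicator 1
      have hpair : ∀ i j, χ (Sum.inl i) = χ (Sum.inr j) := by
        intro i j
        obtain ⟨a, ha, hav⟩ := hex (Pi.single (i, j) 1)
        have key : ∀ c : Fin n × Fin d → ℝ,
            ∑ k, χ (Sum.inl k) * (marginals c).1 k - ∑ l, χ (Sum.inr l) * (marginals c).2 l =
              ∑ e : Fin n × Fin d, (χ (Sum.inl e.1) - χ (Sum.inr e.2)) * c e := by
          intro c
          simp only [marginals_fst, marginals_snd, Finset.mul_sum, Fintype.sum_prod_type, sub_mul,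
            Finset.sum_sub_distrib]
          congr 1
          rw [Finset.sum_comm]
        have h1 := key a
        have h2 := key (Pi.single (i, j) 1)
        rw [show marginals a = marginals (Pi.single (i, j) 1) from hav, h2,
          Finset.sum_eq_single (i, j) (by simp +contextual) (by simp),
          Finset.sum_eq_zero] at h1
        · simpa [sub_eq_zero] using h1
        · intro e _
          by_cases he : e ∈ edgePairs t
          · have hiff : Sum.inl e.1 ∈ A ↔ Sum.inr e.2 ∈ A :=
              ⟨fun h => h.trans (Adj.reachable he), fun h => h.trans (Adj.reachable he).symm⟩
            by_cases h : Sum.inl e.1 ∈ A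
            · simp [χ, h, hiff.1 h]
            · have h' : Sum.inr e.2 ∉ A := mt hiff.2 h
              simp [χ, h, h']
          · rw [ha e he, mul_zero]
      have hconst : ∀ y z, χ y = χ z := by
        have hi : χ (Sum.inl ⟨0, hn⟩) = χ (Sum.inr ⟨0, hd⟩) := hpair _ _
        have h0 : ∀ y, χ y = χ (Sum.inl ⟨0, hn⟩) := by
          rintro (i | j)
          · rw [hi]; exact hpair _ _
          · exact (hpair _ _).symm
        exact fun y z => (h0 y).trans (h0 z).symm
      intro y
      have hx : χ x = 1 := Set.indicator_of_mem (show x ∈ A from Reachable.refl x) _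
      by_contra hy
      have hy' : χ y = 0 := Set.indicator_of_notMem (show y ∉ A from hy) _
      exact one_ne_zero (hx.symm.trans ((hconst x y).trans hy'))
    have : Nontrivial (Fin n ⊕ Fin d) :=
      ⟨⟨Sum.inl ⟨0, hn⟩, Sum.inr ⟨0, hd⟩, by simp⟩⟩
    refine ⟨fun x => ?_, ⟨⟨hpre⟩, hacyc⟩⟩
    obtain ⟨y, hy⟩ := hpre.exists_adj_of_nontrivial x
    exact (show t.Adj x y from hy).fst_mem

end Trees

/-! ### The polytope and its vertices -/

section Geometry

variable {n d : ℕ}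

lemma sum_marginals_fst (a : Fin n × Fin d → ℝ) : ∑ i, (marginals a).1 i = ∑ e, a e := by
  simp only [marginals_fst, Fintype.sum_prod_type]

lemma sum_marginals_snd (a : Fin n × Fin d → ℝ) : ∑ j, (marginals a).2 j = ∑ e, a e := by
  simp only [marginals_snd, Fintype.sum_prod_type]
  rw [Finset.sum_comm]

lemma mem_productOfSimplices_iff {x : (Fin n → ℝ) × (Fin d → ℝ)} :
    x ∈ productOfSimplices n d ↔
      ∃ a : Fin n × Fin d → ℝ, 0 ≤ a ∧ ∑ e, a e = 1 ∧ marginals a = x := by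
  constructor
  · rintro ⟨⟨h0, h1⟩, ⟨h0', h1'⟩⟩
    refine ⟨fun e => x.1 e.1 * x.2 e.2, fun e => mul_nonneg (h0 _) (h0' _), ?_, ?_⟩
    · simp [Fintype.sum_prod_type, ← Finset.mul_sum, h1, h1']
    · ext k
      · rw [marginals_fst]; simp [← Finset.mul_sum, h1']
      · rw [marginals_snd]; simp [← Finset.sum_mul, h1]
  · rintro ⟨a, ha, ha1, rfl⟩
    refine ⟨⟨fun i => ?_, ?_⟩, ⟨fun j => ?_, ?_⟩⟩
    · rw [marginals_fst]; exact Finset.sum_nonneg fun j _ => ha _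
    · rw [sum_marginals_fst, ha1]
    · rw [marginals_snd]; exact Finset.sum_nonneg fun i _ => ha _
    · rw [sum_marginals_snd, ha1]

lemma productOfSimplices_eq_convexHull :
    productOfSimplices n d = convexHull ℝ (edgeVector '' Set.univ) := by
  ext x
  rw [mem_productOfSimplices_iff, mem_convexHull_image_iff]
  simp

lemma encodedVertices_eq_image (t : (bipartiteK n d).Subgraph) :
    encodedVertices t = edgeVector '' edgePairs t := by
  ext x
  constructor
  · rintro ⟨i, j, h, rfl⟩
    exact ⟨(i, j), h, rfl⟩
  · rintro ⟨e, he, rfl⟩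
    exact ⟨e.1, e.2, he, rfl⟩

lemma single_mem_extremePoints_stdSimplex {ι : Type*} [Fintype ι] [DecidableEq ι] (i : ι) :
    Pi.single i 1 ∈ (stdSimplex ℝ ι).extremePoints ℝ := by
  rw [mem_extremePoints]
  refine ⟨single_mem_stdSimplex ℝ i, ?_⟩
  have key : ∀ y ∈ stdSimplex ℝ ι, (∀ k ≠ i, y k = 0) → y = Pi.single i 1 := by
    intro y hy h
    have h1 := hy.2
    rw [Finset.sum_eq_single i (fun k _ hk => h k hk) (by simp)] at h1
    ext k
    by_cases hk : k = i
    · subst hk; simp [h1]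
    · simp [h k hk, hk]
  rintro y hy z hz ⟨α, β, hα, hβ, -, h⟩
  have h0 : ∀ k ≠ i, y k = 0 ∧ z k = 0 := by
    intro k hk
    have h1 := congrFun h k
    simp only [Pi.add_apply, Pi.smul_apply, smul_eq_mul, Pi.single_eq_of_ne hk] at h1
    have h2 := mul_nonneg hα.le (hy.1 k)
    have h3 := mul_nonneg hβ.le (hz.1 k)
    exact ⟨(mul_eq_zero.1 (by linarith)).resolve_left hα.ne',
      (mul_eq_zero.1 (by linarith)).resolve_left hβ.ne'⟩
  exact ⟨key y hy fun k hk => (h0 k hk).1, key z hz fun k hk => (h0 k hk).2⟩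

lemma edgeVector_mem_extremePoints (e : Fin n × Fin d) :
    edgeVector e ∈ (productOfSimplices n d).extremePoints ℝ := by
  rw [productOfSimplices, extremePoints_prod]
  exact ⟨single_mem_extremePoints_stdSimplex _, single_mem_extremePoints_stdSimplex _⟩

lemma edgeVector_mem_convexHull_iff {A : Set (Fin n × Fin d)} {e : Fin n × Fin d} :
    edgeVector e ∈ convexHull ℝ (edgeVector '' A) ↔ e ∈ A := by
  refine ⟨fun h => ?_, fun h => subset_convexHull ℝ _ ⟨e, h, rfl⟩⟩
  have h1 := extremePoints_convexHull_subset (𝕜 := ℝ) (A := edgeVector '' A)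
    (inter_extremePoints_subset_extremePoints_of_subset
      (show convexHull ℝ (edgeVector '' A) ⊆ productOfSimplices n d by
        rw [productOfSimplices_eq_convexHull]
        exact convexHull_mono (Set.image_mono (Set.subset_univ _)))
      ⟨h, edgeVector_mem_extremePoints e⟩)
  exact edgeVector_injective.mem_set_image.1 h1

/-- All edge vectors lie on a common affine hyperplane that misses the origin, so their affine
independence is the same as their linear independence. -/
lemma affineIndependent_edgeVector_iff {A : Set (Fin n × Fin d)} :
    AffineIndependent ℝ ((↑) : (edgeVector '' A : Set _) → (Fin n → ℝ) × (Fin d → ℝ)) ↔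
      ∀ a b : Fin n × Fin d → ℝ, (∀ e ∉ A, a e = 0) → (∀ e ∉ A, b e = 0) →
        marginals a = marginals b → a = b := by
  classical
  constructor
  · intro h a b ha hb hab
    let φ : A ↪ (edgeVector '' A : Set ((Fin n → ℝ) × (Fin d → ℝ))) :=
      ⟨fun e => ⟨edgeVector e.1, e.1, e.2, rfl⟩, fun e f hef =>
        Subtype.ext (edgeVector_injective (congrArg Subtype.val hef))⟩
    have hA := h.comp_embedding φ
    rw [affineIndependent_iff] at hA
    obtain ⟨c, hc⟩ : ∃ c, c = a - b := ⟨_, rfl⟩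
    have hsupp : ∀ e ∉ A, c e = 0 := fun e he => by simp [hc, ha e he, hb e he]
    have hc0 : marginals c = 0 := by rw [hc, map_sub, hab, sub_self]
    have hsum : ∑ e : A, c e = 0 := by
      rw [sum_coe_of_support hsupp, ← sum_marginals_fst, hc0]
      simp
    have hcomb : ∑ e : A, c e • edgeVector e.1 = 0 := by
      rw [sum_coe_of_support (F := fun e => c e • edgeVector e)
        fun e he => by rw [hsupp e he, zero_smul], ← hc0, marginals,
        Fintype.linearCombination_apply]
    have h0 := hA Finset.univ (fun e => c e.1) hsum hcomb
    rw [← sub_eq_zero, ← hc]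
    ext e
    by_cases he : e ∈ A
    · exact h0 ⟨e, he⟩ (Finset.mem_univ _)
    · exact hsupp e he
  · intro h
    have hA : LinearIndependent ℝ (fun e : A => edgeVector e.1) := by
      rw [Fintype.linearIndependent_iff]
      intro g hg e
      let a : Fin n × Fin d → ℝ := fun e => if he : e ∈ A then g ⟨e, he⟩ else 0
      have ha : ∀ e ∉ A, a e = 0 := fun e he => dif_neg he
      have hag : ∀ e : A, a e = g e := fun e => by simp [a]
      have : a = 0 := h a 0 ha (fun _ _ => rfl) (by
        rw [map_zero, ← hg, marginals, Fintype.linearCombination_apply,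
          ← sum_coe_of_support (A := A) fun e he => by rw [ha e he, zero_smul]]
        simp only [hag])
      rw [← hag, this]
      rfl
    have := hA.affineIndependent.range
    rwa [show Set.range (fun e : A => edgeVector e.1) = edgeVector '' A from
      (Set.image_eq_range _ _).symm] at this

lemma edgeVector_mem_affineSpan {A : Set (Fin n × Fin d)} (hA : IsCoordinateSet edgeVector A)
    (e : Fin n × Fin d) : edgeVector e ∈ affineSpan ℝ (edgeVector '' A) := by
  classical
  obtain ⟨a, ha, hae⟩ := hA.1 (Pi.single e 1)
  have h1 : ∑ g : A, a g = 1 := by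
    rw [sum_coe_of_support ha, ← sum_marginals_fst, show marginals a = _ from hae,
      sum_marginals_fst]
    simp
  have h2 := affineCombination_mem_affineSpan h1 (fun g : A => edgeVector g.1)
  rw [Finset.affineCombination_eq_linear_combination _ _ _ h1,
    sum_coe_of_support (F := fun g => a g • edgeVector g) fun g hg => by rw [ha g hg, zero_smul],
    ← Fintype.linearCombination_apply, hae, Fintype.linearCombination_apply_single, one_smul,
    ← Set.image_eq_range] at h2
  exact h2

end Geometry

/-! ### Triangulations -/

section Triangulations

open Filter Topology

variable {n d : ℕ}

/-- A point of two cells of a triangulation lies in a common face, spanned by common vertices, and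
so has the same coordinates in both cells. -/
lemma EncodesTriangulation.eq_of_marginals_eq {T : Set (bipartiteK n d).Subgraph}
    (hT : EncodesTriangulation T) {t s : (bipartiteK n d).Subgraph} (ht : t ∈ T) (hs : s ∈ T)
    {a b : Fin n × Fin d → ℝ} (hat : ∀ e ∉ edgePairs t, a e = 0) (hbs : ∀ e ∉ edgePairs s, b e = 0)
    (ha : 0 ≤ a) (hb : 0 ≤ b) (hab : marginals a = marginals b) : a = b := by
  have huniq : ∀ r ∈ T, ∀ a b : Fin n × Fin d → ℝ, (∀ e ∉ edgePairs r, a e = 0) →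
      (∀ e ∉ edgePairs r, b e = 0) → marginals a = marginals b → a = b := fun r hr => by
    have := hT.simplex _ ⟨r, hr, rfl⟩
    rw [encodedVertices_eq_image] at this
    exact affineIndependent_edgeVector_iff.1 this
  have hsum : ∑ e, a e = ∑ e, b e := by
    rw [← sum_marginals_fst, hab, sum_marginals_fst]
  rcases (Finset.sum_nonneg fun e _ => ha e : 0 ≤ ∑ e, a e).eq_or_lt with h0 | hpos
  · have h1 : ∀ c : Fin n × Fin d → ℝ, 0 ≤ c → ∑ e, c e = 0 → c = 0 := fun c hc h => by
      rw [Finset.sum_eq_zero_iff_of_nonneg fun e _ => hc e] at h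
      exact funext fun e => h e (Finset.mem_univ e)
    rw [h1 a ha h0.symm, h1 b hb (hsum.symm.trans h0.symm)]
  · set σ := ∑ e, a e with hσ
    have hσ0 : 0 ≤ σ⁻¹ := inv_nonneg.2 hpos.le
    have hmem : ∀ (r : (bipartiteK n d).Subgraph) (c : Fin n × Fin d → ℝ), 0 ≤ c →
        (∀ e ∉ edgePairs r, c e = 0) → ∑ e, c e = σ →
        marginals (σ⁻¹ • c) ∈ convexHull ℝ (encodedVertices r) := by
      intro r c hc hcr hcσ
      rw [encodedVertices_eq_image, mem_convexHull_image_iff]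
      refine ⟨σ⁻¹ • c, smul_nonneg hσ0 hc, fun e he => by simp [hcr e he], ?_, rfl⟩
      simp only [Pi.smul_apply, smul_eq_mul, ← Finset.mul_sum, hcσ]
      exact inv_mul_cancel₀ hpos.ne'
    have hxt := hmem t a ha hat hσ.symm
    have hxs := hmem s b hb hbs hsum.symm
    have hx : marginals (σ⁻¹ • a) = marginals (σ⁻¹ • b) := by rw [map_smul, map_smul, hab]
    obtain ⟨⟨ρ, hρt, hρ⟩, ⟨ρ', hρs, hρ'⟩⟩ := hT.inter_face _ ⟨t, ht, rfl⟩ _ ⟨s, hs, rfl⟩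
    have hρst : ρ ⊆ edgeVector '' (edgePairs t ∩ edgePairs s) := by
      intro y hy
      obtain ⟨e, he, rfl⟩ := encodedVertices_eq_image t ▸ hρt hy
      refine ⟨e, ⟨he, ?_⟩, rfl⟩
      rw [← edgeVector_mem_convexHull_iff, ← encodedVertices_eq_image]
      exact (hρ ▸ subset_convexHull ℝ ρ hy : _ ∈ convexHull ℝ _ ∩ convexHull ℝ _).2
    have hmemρ : marginals (σ⁻¹ • a) ∈ convexHull ℝ ρ := hρ ▸ ⟨hxt, hx ▸ hxs⟩
    obtain ⟨c, -, hcs, -, hc⟩ := mem_convexHull_image_iff.1 (convexHull_mono hρst hmemρ)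
    have h1 := huniq t ht c (σ⁻¹ • a) (fun e he => hcs e fun h => he h.1)
      (fun e he => by simp [hat e he]) hc
    have h2 := huniq s hs c (σ⁻¹ • b) (fun e he => hcs e fun h => he h.2)
      (fun e he => by simp [hbs e he]) (hc.trans hx)
    exact smul_right_injective _ (inv_ne_zero hpos.ne') (h1.symm.trans h2)

/-- The triangulation property in terms of matrices: the members of `T` give bases, nonnegative
representations over members of `T` are unique, and every nonnegative combination of the edge
vectors has such a representation. -/
theorem encodesTriangulation_iff {T : Set (bipartiteK n d).Subgraph} (hne : T.Nonempty) :
    EncodesTriangulation T ↔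
      (∀ t ∈ T, IsCoordinateSet edgeVector (edgePairs t)) ∧
      HasUniqueRepresentations edgeVector (edgePairs '' T) ∧
      (∀ p : Fin n × Fin d → ℝ, 0 ≤ p → ∃ t ∈ T, ∃ a : Fin n × Fin d → ℝ,
        (∀ e ∉ edgePairs t, a e = 0) ∧ 0 ≤ a ∧ marginals a = marginals p) := by
  constructor
  · intro hT
    refine ⟨fun t ht => isCoordinateSet_of_mem_span (fun e => ?_) ?_, ?_, fun p hp => ?_⟩
    · have h1 : edgeVector e ∈ affineSpan ℝ (productOfSimplices n d) :=
        subset_affineSpan ℝ _ (edgeVector_mem_extremePoints e).1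
      rw [← hT.full_dim _ ⟨t, ht, rfl⟩, encodedVertices_eq_image] at h1
      exact affineSpan_subset_span h1
    · have := hT.simplex _ ⟨t, ht, rfl⟩
      rw [encodedVertices_eq_image] at this
      exact affineIndependent_edgeVector_iff.1 this
    · rintro _ ⟨t, ht, rfl⟩ _ ⟨s, hs, rfl⟩ a b hat hbs ha hb hab
      exact hT.eq_of_marginals_eq ht hs hat hbs ha hb hab
    · rcases (Finset.sum_nonneg fun e _ => hp e : 0 ≤ ∑ e, p e).eq_or_lt with h0 | hpos
      · obtain ⟨t, ht⟩ := hne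
        have h1 := h0.symm
        rw [Finset.sum_eq_zero_iff_of_nonneg fun e _ => hp e] at h1
        have : p = 0 := funext fun e => h1 e (Finset.mem_univ e)
        exact ⟨t, ht, 0, fun _ _ => rfl, le_rfl, by rw [this]⟩
      · set σ := ∑ e, p e with hσ
        have hx : marginals (σ⁻¹ • p) ∈ productOfSimplices n d := by
          refine mem_productOfSimplices_iff.2
            ⟨_, smul_nonneg (inv_nonneg.2 hpos.le) hp, ?_, rfl⟩
          simp only [Pi.smul_apply, smul_eq_mul, ← Finset.mul_sum, ← hσ]
          exact inv_mul_cancel₀ hpos.ne'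
        rw [← hT.cover, Set.mem_iUnion₂] at hx
        obtain ⟨_, ⟨t, ht, rfl⟩, hx⟩ := hx
        rw [encodedVertices_eq_image, mem_convexHull_image_iff] at hx
        obtain ⟨a, ha, has, -, hap⟩ := hx
        refine ⟨t, ht, σ • a, fun e he => by simp [has e he], smul_nonneg hpos.le ha, ?_⟩
        rw [map_smul, show marginals a = _ from hap, map_smul, smul_inv_smul₀ hpos.ne']
  · rintro ⟨hbasis, huniq, hcover⟩
    have himage : ∀ t : (bipartiteK n d).Subgraph,
        encodedVertices t ⊆ productOfSimplices n d := fun t => by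
      rw [encodedVertices_eq_image]
      rintro _ ⟨e, -, rfl⟩
      exact (edgeVector_mem_extremePoints e).1
    have hconv : Convex ℝ (productOfSimplices n d) :=
      productOfSimplices_eq_convexHull (n := n) (d := d) ▸ convex_convexHull ℝ _
    have hface : ∀ t ∈ T, ∀ s ∈ T, convexHull ℝ (encodedVertices t) ∩
        convexHull ℝ (encodedVertices s) =
          convexHull ℝ (edgeVector '' (edgePairs t ∩ edgePairs s)) := by
      intro t ht s hs
      rw [encodedVertices_eq_image, encodedVertices_eq_image]
      refine Set.Subset.antisymm ?_ (Set.subset_inter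
        (convexHull_mono (Set.image_mono Set.inter_subset_left))
        (convexHull_mono (Set.image_mono Set.inter_subset_right)))
      rintro x ⟨hxt, hxs⟩
      rw [mem_convexHull_image_iff] at hxt hxs ⊢
      obtain ⟨a, ha, hat, ha1, hax⟩ := hxt
      obtain ⟨b, hb, hbs, -, hbx⟩ := hxs
      have hab := huniq _ ⟨t, ht, rfl⟩ _ ⟨s, hs, rfl⟩ a b hat hbs ha hb (hax.trans hbx.symm)
      refine ⟨a, ha, fun e he => ?_, ha1, hax⟩
      by_cases het : e ∈ edgePairs t
      · rw [hab]; exact hbs e fun h => he ⟨het, h⟩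
      · exact hat e het
    refine ⟨?_, ?_, ?_, ?_, ?_, ?_⟩
    · rw [show (encodedVertices : (bipartiteK n d).Subgraph → _) =
        fun t => edgeVector '' edgePairs t from funext encodedVertices_eq_image,
        ← Set.image_image (fun A => edgeVector '' A) edgePairs]
      exact (Set.toFinite _).image _
    · rintro _ ⟨t, -, rfl⟩
      rw [encodedVertices_eq_image]
      rintro _ ⟨e, -, rfl⟩
      exact edgeVector_mem_extremePoints e
    · rintro _ ⟨t, ht, rfl⟩
      rw [encodedVertices_eq_image]
      exact affineIndependent_edgeVector_iff.2 (hbasis t ht).2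
    · rintro _ ⟨t, ht, rfl⟩
      refine le_antisymm (affineSpan_mono ℝ (himage t)) ?_
      rw [productOfSimplices_eq_convexHull, affineSpan_convexHull, affineSpan_le,
        encodedVertices_eq_image]
      rintro _ ⟨e, -, rfl⟩
      exact edgeVector_mem_affineSpan (hbasis t ht) e
    · refine Set.Subset.antisymm (Set.iUnion₂_subset ?_) fun x hx => ?_
      · rintro _ ⟨t, -, rfl⟩
        exact convexHull_min (himage t) hconv
      · obtain ⟨p, hp, hp1, rfl⟩ := mem_productOfSimplices_iff.1 hx
        obtain ⟨t, ht, a, hat, ha, hap⟩ := hcover p hp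
        refine Set.mem_iUnion₂.2 ⟨_, ⟨t, ht, rfl⟩, ?_⟩
        rw [encodedVertices_eq_image, mem_convexHull_image_iff]
        exact ⟨a, ha, hat, by rw [← sum_marginals_fst, hap, sum_marginals_fst, hp1], hap⟩
    · rintro _ ⟨t, ht, rfl⟩ _ ⟨s, hs, rfl⟩
      rw [hface t ht s hs]
      exact ⟨⟨_, by rw [encodedVertices_eq_image]; exact Set.image_mono Set.inter_subset_left, rfl⟩,
        ⟨_, by rw [encodedVertices_eq_image]; exact Set.image_mono Set.inter_subset_right, rfl⟩⟩

lemma mem_edgeSet_iff_mem_edgePairs {t : (bipartiteK n d).Subgraph} {e : Fin n × Fin d} :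
    s(Sum.inl e.1, Sum.inr e.2) ∈ t.edgeSet ↔ e ∈ edgePairs t := Iff.rfl

lemma exists_eq_mk_of_mem_edgeSet {f : Sym2 (Fin n ⊕ Fin d)}
    (hf : f ∈ (bipartiteK n d).edgeSet) :
    ∃ e : Fin n × Fin d, f = s(Sum.inl e.1, Sum.inr e.2) := by
  induction f with | _ x y
  rcases x with i | j <;> rcases y with i' | j'
  · simp at hf
  · exact ⟨(i, j'), rfl⟩
  · exact ⟨(i', j), Sym2.eq_swap⟩
  · simp at hf

lemma mk_inl_inr_injective :
    Function.Injective fun e : Fin n × Fin d =>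
      (s(Sum.inl e.1, Sum.inr e.2) : Sym2 (Fin n ⊕ Fin d)) := by
  rintro ⟨i, j⟩ ⟨i', j'⟩ h
  simpa using h

lemma edgeSet_eq_iff {t t' : (bipartiteK n d).Subgraph} {e f : Fin n × Fin d} :
    t'.edgeSet = (t.edgeSet \ {s(Sum.inl e.1, Sum.inr e.2)}) ∪ {s(Sum.inl f.1, Sum.inr f.2)} ↔
      edgePairs t' = insert f (edgePairs t \ {e}) := by
  have hmk : ∀ g g' : Fin n × Fin d, (s(Sum.inl g.1, Sum.inr g.2) : Sym2 (Fin n ⊕ Fin d)) =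
      s(Sum.inl g'.1, Sum.inr g'.2) ↔ g = g' := fun g g' => mk_inl_inr_injective.eq_iff
  constructor
  · intro h
    ext g
    rw [← mem_edgeSet_iff_mem_edgePairs, h]
    simp only [Set.mem_union, Set.mem_sdiff, Set.mem_singleton_iff, hmk, Set.mem_insert_iff,
      mem_edgeSet_iff_mem_edgePairs]
    tauto
  · intro h
    ext x
    by_cases hx : x ∈ (bipartiteK n d).edgeSet
    · obtain ⟨g, rfl⟩ := exists_eq_mk_of_mem_edgeSet hx
      rw [mem_edgeSet_iff_mem_edgePairs, h]
      simp only [Set.mem_union, Set.mem_sdiff, Set.mem_singleton_iff, hmk, Set.mem_insert_iff,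
        mem_edgeSet_iff_mem_edgePairs]
      tauto
    · refine iff_of_false (fun h' => hx (t'.edgeSet_subset h')) ?_
      rintro (h' | h')
      · exact hx (t.edgeSet_subset h'.1)
      · exact hx (by rw [Set.mem_singleton_iff.1 h']; simp)

/-- For collections of spanning trees, unique nonnegative representation is the absence of
alternating cycles between different members. -/
theorem hasUniqueRepresentations_iff (hn : 1 ≤ n) (hd : 1 ≤ d)
    {T : Set (bipartiteK n d).Subgraph} (htree : ∀ t ∈ T, IsSpanningTree t) :
    HasUniqueRepresentations edgeVector (edgePairs '' T) ↔
      ¬ ∃ t ∈ T, ∃ s ∈ T, t ≠ s ∧ ∃ (v : Fin n ⊕ Fin d) (c : (bipartiteK n d).Walk v v),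
        c.IsCycle ∧ AlternatesBetween c t s := by
  constructor
  · rintro huniq ⟨t, ht, s, hs, -, v, p, hp, halt⟩
    obtain ⟨a, b, ha, hb, hat, hbs, hab, hne⟩ := exists_ne_of_alternating_cycle hp halt
    exact hne (huniq _ ⟨t, ht, rfl⟩ _ ⟨s, hs, rfl⟩ a b hat hbs ha hb hab)
  · rintro hno _ ⟨t, ht, rfl⟩ _ ⟨s, hs, rfl⟩ a b hat hbs ha hb hab
    by_cases hts : t = s
    · subst hts
      exact ((isSpanningTree_iff_isCoordinateSet hn hd).1 (htree t ht)).2 a b hat hbs hab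
    · by_contra hne
      refine hno ⟨t, ht, s, hs, hts, exists_alternating_cycle (c := a - b)
        (by rw [map_sub, sub_eq_zero]; exact hab) (sub_ne_zero.2 hne) (fun e he => ?_)
        fun e he => ?_⟩
      · by_contra h
        have := hb e
        simp only [Pi.sub_apply, hat e h, Pi.zero_apply] at he this
        linarith
      · by_contra h
        have := ha e
        simp only [Pi.sub_apply, hbs e h, Pi.zero_apply] at he this
        linarith

/-- Covering implies flips: the sum of the vertices of an interior wall, pushed across the wall by a
multiple of `-v e`, lies in the cone over some other member of `T` for arbitrarily small pushes, and
that member contains the wall. -/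
lemma exists_flip_of_cover {T : Set (bipartiteK n d).Subgraph}
    (hbasis : ∀ t ∈ T, IsCoordinateSet edgeVector (edgePairs t))
    (huniq : HasUniqueRepresentations edgeVector (edgePairs '' T))
    (hcover : ∀ p : Fin n × Fin d → ℝ, 0 ≤ p → ∃ t ∈ T, ∃ a : Fin n × Fin d → ℝ,
      (∀ e ∉ edgePairs t, a e = 0) ∧ 0 ≤ a ∧ marginals a = marginals p)
    {t : (bipartiteK n d).Subgraph} (ht : t ∈ T) {e : Fin n × Fin d} (he : e ∈ edgePairs t)
    (hrow : ∃ j ≠ e.2, (e.1, j) ∈ edgePairs t) (hcol : ∃ i ≠ e.1, (i, e.2) ∈ edgePairs t) :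
    ∃ f ∉ edgePairs t, ∃ t' ∈ T, edgePairs t' = insert f (edgePairs t \ {e}) := by
  classical
  obtain ⟨j, hj, hjt⟩ := hrow
  obtain ⟨i, hi, hit⟩ := hcol
  let w : Fin n × Fin d → ℝ := fun g => if g ∈ edgePairs t \ {e} then 1 else 0
  have hw0 : 0 ≤ w := fun g => by simp only [w, Pi.zero_apply]; split_ifs <;> norm_num
  have hw1 : ∀ g ∈ edgePairs t, g ≠ e → w g = 1 := fun g hg hge => if_pos ⟨hg, hge⟩
  have hwt : ∀ g ∉ edgePairs t, w g = 0 := fun g hg => if_neg fun h => hg h.1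
  have hwe : w e = 0 := if_neg fun h => h.2 rfl
  have hα : ∀ s : T, ∃ a : Fin n × Fin d → ℝ, (∀ g ∉ edgePairs s.1, a g = 0) ∧
      marginals a = marginals w := fun s => (hbasis s s.2).1 w
  have hβ : ∀ s : T, ∃ a : Fin n × Fin d → ℝ, (∀ g ∉ edgePairs s.1, a g = 0) ∧
      marginals a = marginals (Pi.single e 1) := fun s => (hbasis s s.2).1 _
  choose α hαs hαw using hα
  choose β hβs hβe using hβ
  -- Since `v_{e.1,j} + v_{i,e.2} = v_e + v_{i,j}`, small multiples of `v_e` can be subtracted.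
  have hpush : ∀ ε : ℝ, 0 < ε → ε ≤ 1 → ∃ s : T, 0 ≤ α s - ε • β s := by
    intro ε hε hε1
    have hsq : marginals (Pi.single (e.1, j) 1) + marginals (Pi.single (i, e.2) 1) =
        marginals (Pi.single e 1) + marginals (Pi.single (i, j) 1) := by
      simp only [marginals_single, edgeVector, productVertex, Prod.mk_add_mk]
      exact Prod.ext rfl (add_comm _ _)
    let p : Fin n × Fin d → ℝ :=
      w - ε • (Pi.single (e.1, j) 1 + Pi.single (i, e.2) 1) + ε • Pi.single (i, j) 1
    have hp : 0 ≤ p := by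
      have h1 : (0 : Fin n × Fin d → ℝ) ≤ ε • Pi.single (i, j) 1 :=
        smul_nonneg hε.le (Pi.single_nonneg.2 zero_le_one)
      refine add_nonneg (fun g => ?_) h1
      have hne : (e.1, j) ≠ (i, e.2) := fun h => hi (congrArg Prod.fst h).symm
      by_cases hg1 : g = (e.1, j)
      · subst hg1
        have := hw1 _ hjt fun h => hj (congrArg Prod.snd h)
        simpa [this, Pi.single_eq_of_ne hne] using hε1
      · by_cases hg2 : g = (i, e.2)
        · subst hg2
          have := hw1 _ hit fun h => hi (congrArg Prod.fst h)
          simpa [this, Pi.single_eq_of_ne hne.symm] using hε1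
        · simpa [hg1, hg2] using hw0 g
    have hpm : marginals p = marginals (w - ε • Pi.single e 1) := by
      simp only [p, map_add, map_sub, map_smul]
      rw [hsq, smul_add]
      abel
    obtain ⟨s, hs, a, has, ha, hap⟩ := hcover p hp
    refine ⟨⟨s, hs⟩, ?_⟩
    have : a = α ⟨s, hs⟩ - ε • β ⟨s, hs⟩ := (hbasis s hs).2 _ _ has
      (fun g hg => by simp [hαs ⟨s, hs⟩ g hg, hβs ⟨s, hs⟩ g hg]) (by
        have h1 := hαw ⟨s, hs⟩
        have h2 := hβe ⟨s, hs⟩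
        rw [map_sub, map_smul]
        rw [map_sub, map_smul] at hpm
        exact (hap.trans hpm).trans (by rw [h1, h2]))
    rw [← this]
    exact ha
  obtain ⟨s, hst, hs0⟩ : ∃ s : T, edgePairs s.1 ≠ edgePairs t ∧ 0 ≤ α s := by
    by_contra! hcon
    have hev : ∀ s : T, ∀ᶠ ε in 𝓝[>] (0 : ℝ), ¬ 0 ≤ α s - ε • β s := by
      intro s
      by_cases hs : edgePairs s.1 = edgePairs t
      · have h1 : α s = w := (hbasis t ht).2 _ _ (hs ▸ hαs s) hwt (hαw s)
        have h2 : β s = Pi.single e 1 := (hbasis t ht).2 _ _ (hs ▸ hβs s)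
          (fun g hg => Pi.single_eq_of_ne (fun h : g = e => hg (h ▸ he)) _) (hβe s)
        filter_upwards [self_mem_nhdsWithin] with ε hε h
        have h3 := h e
        have hε' : 0 < ε := hε
        simp only [h1, h2, Pi.zero_apply, Pi.sub_apply, Pi.smul_apply, hwe, Pi.single_eq_same,
          smul_eq_mul, mul_one] at h3
        linarith
      · obtain ⟨g, hg⟩ : ∃ g, α s g < 0 := by
          by_contra! h
          exact hcon s hs h
        have hcont : Continuous fun ε : ℝ => α s g - ε * β s g := by fun_prop
        have hlt := (hcont.tendsto 0).eventually_lt_const (u := 0) (by simpa using hg)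
        filter_upwards [hlt.filter_mono nhdsWithin_le_nhds] with ε hε h
        exact absurd (h g) (not_le.2 hε)
    obtain ⟨ε, hε, hε0, hε1⟩ :=
      ((eventually_all.2 hev).and (Ioc_mem_nhdsGT (zero_lt_one (α := ℝ)))).exists
    obtain ⟨s, hs⟩ := hpush ε hε0 hε1
    exact hε s hs
  have hα_eq : w = α s := huniq _ ⟨t, ht, rfl⟩ _ ⟨s, s.2, rfl⟩ _ _ hwt (hαs s) hw0 hs0 (hαw s).symm
  have hsub : edgePairs t \ {e} ⊆ edgePairs s.1 := fun g hg => by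
    by_contra h
    have h1 := hw1 g hg.1 hg.2
    rw [hα_eq, hαs s g h] at h1
    exact zero_ne_one h1
  obtain ⟨f, hf, h⟩ := (hbasis t ht).exists_eq_insert (hbasis s s.2) he hsub hst.symm
  exact ⟨f, hf, s, s.2, h⟩

/-- An edge with a leaf as an endpoint gives a wall on the boundary: the coordinate of the leaf is a
supporting linear form. -/
lemma exists_supporting_form_of_leaf {t : (bipartiteK n d).Subgraph} {e : Fin n × Fin d}
    (h : (∀ j, (e.1, j) ∈ edgePairs t → j = e.2) ∨
      (∀ i, (i, e.2) ∈ edgePairs t → i = e.1)) :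
    ∃ ℓ : (Fin n → ℝ) × (Fin d → ℝ) →ₗ[ℝ] ℝ, (∀ g : Fin n × Fin d, 0 ≤ ℓ (edgeVector g)) ∧
      (∀ g ∈ edgePairs t, g ≠ e → ℓ (edgeVector g) = 0) ∧ 0 < ℓ (edgeVector e) := by
  rcases h with h | h
  · refine ⟨(LinearMap.proj e.1).comp (LinearMap.fst ℝ _ _), fun g => ?_, fun g hg hge => ?_, ?_⟩
    · simp only [edgeVector, productVertex, LinearMap.comp_apply, LinearMap.fst_apply,
        LinearMap.proj_apply, Pi.single_apply]
      split_ifs <;> norm_num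
    · have : e.1 ≠ g.1 := fun h' => hge (Prod.ext h'.symm (h g.2 (h' ▸ hg)))
      simp [edgeVector, productVertex, Pi.single_eq_of_ne this]
    · simp [edgeVector, productVertex]
  · refine ⟨(LinearMap.proj e.2).comp (LinearMap.snd ℝ _ _), fun g => ?_, fun g hg hge => ?_, ?_⟩
    · simp only [edgeVector, productVertex, LinearMap.comp_apply, LinearMap.snd_apply,
        LinearMap.proj_apply, Pi.single_apply]
      split_ifs <;> norm_num
    · have : e.2 ≠ g.2 := fun h' => hge (Prod.ext (h g.1 (h' ▸ hg)) h'.symm)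
      simp [edgeVector, productVertex, Pi.single_eq_of_ne this]
    · simp [edgeVector, productVertex]

lemma isInternalEdge_iff {t : (bipartiteK n d).Subgraph} {e : Fin n × Fin d}
    (he : e ∈ edgePairs t) :
    IsInternalEdge t s(Sum.inl e.1, Sum.inr e.2) ↔
      (∃ j ≠ e.2, (e.1, j) ∈ edgePairs t) ∧ (∃ i ≠ e.1, (i, e.2) ∈ edgePairs t) := by
  have hl : IsLeafOf t (Sum.inl e.1) ↔ ∀ j, (e.1, j) ∈ edgePairs t → j = e.2 := by
    constructor
    · rintro ⟨w, -, hw⟩ j hj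
      exact Sum.inr_injective ((hw _ hj).trans (hw _ he).symm)
    · intro h
      refine ⟨Sum.inr e.2, he, ?_⟩
      rintro (i | j) hw
      · simpa using hw.adj_sub
      · rw [h j hw]
  have hr : IsLeafOf t (Sum.inr e.2) ↔ ∀ i, (i, e.2) ∈ edgePairs t → i = e.1 := by
    constructor
    · rintro ⟨w, -, hw⟩ i hi
      exact Sum.inl_injective ((hw _ hi.symm).trans (hw _ he.symm).symm)
    · intro h
      refine ⟨Sum.inl e.1, he.symm, ?_⟩
      rintro (i | j) hw
      · rw [h i hw.symm]
      · simpa using hw.adj_sub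
  have hends : (∀ v ∈ s(Sum.inl e.1, Sum.inr e.2), ¬ IsLeafOf t v) ↔
      ¬ IsLeafOf t (Sum.inl e.1) ∧ ¬ IsLeafOf t (Sum.inr e.2) := by
    simp only [Sym2.mem_iff, forall_eq_or_imp, forall_eq]
  rw [IsInternalEdge, hends, hl, hr, and_iff_right (mem_edgeSet_iff_mem_edgePairs.2 he)]
  push Not
  simp only [and_comm, ne_eq]

end Triangulations

theorem proposition7p2 (n d : ℕ) (hn : 1 ≤ n) (hd : 1 ≤ d)
    (T : Set (bipartiteK n d).Subgraph) (hT : T.Nonempty) :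
    EncodesTriangulation T ↔
      (∀ t ∈ T, IsSpanningTree t) ∧
      (∀ t ∈ T, ∀ e, IsInternalEdge t e →
        ∃ f ∈ (bipartiteK n d).edgeSet, f ≠ e ∧
          ∃ t' ∈ T, t'.edgeSet = (t.edgeSet \ {e}) ∪ {f}) ∧
      (¬ ∃ t ∈ T, ∃ s ∈ T, t ≠ s ∧
        ∃ (v : Fin n ⊕ Fin d) (c : (bipartiteK n d).Walk v v),
          c.IsCycle ∧ AlternatesBetween c t s) := by
  rw [encodesTriangulation_iff hT]
  constructor
  · rintro ⟨hbasis, huniq, hcover⟩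
    have htree : ∀ t ∈ T, IsSpanningTree t := fun t ht =>
      (isSpanningTree_iff_isCoordinateSet hn hd).2 (hbasis t ht)
    refine ⟨htree, fun t ht e' he' => ?_, (hasUniqueRepresentations_iff hn hd htree).1 huniq⟩
    obtain ⟨e, rfl⟩ := exists_eq_mk_of_mem_edgeSet (t.edgeSet_subset he'.1)
    have he : e ∈ edgePairs t := he'.1
    obtain ⟨hrow, hcol⟩ := (isInternalEdge_iff he).1 he'
    obtain ⟨f, hf, t', ht', h⟩ := exists_flip_of_cover hbasis huniq hcover ht he hrow hcol
    refine ⟨s(Sum.inl f.1, Sum.inr f.2), by simp, fun hfe => hf ?_, t', ht', edgeSet_eq_iff.2 h⟩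
    rwa [mk_inl_inr_injective hfe]
  · rintro ⟨htree, hflip, hno⟩
    have hbasis : ∀ t ∈ T, IsCoordinateSet edgeVector (edgePairs t) := fun t ht =>
      (isSpanningTree_iff_isCoordinateSet hn hd).1 (htree t ht)
    have huniq := (hasUniqueRepresentations_iff hn hd htree).2 hno
    refine ⟨hbasis, huniq, fun p hp => ?_⟩
    obtain ⟨_, ⟨t, ht, rfl⟩, h⟩ := exists_nonneg_representation_of_flips (hT.image edgePairs)
      (by rintro _ ⟨t, ht, rfl⟩; exact hbasis t ht) huniq (by
        rintro _ ⟨t, ht, rfl⟩ e he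
        by_cases hint : IsInternalEdge t s(Sum.inl e.1, Sum.inr e.2)
        · left
          obtain ⟨f', hf', hfe, t', ht', h⟩ := hflip t ht _ hint
          obtain ⟨f, rfl⟩ := exists_eq_mk_of_mem_edgeSet hf'
          rw [edgeSet_eq_iff] at h
          refine ⟨f, fun hf => ?_, t', ht', h⟩
          -- If `f` were already in `t`, then `t'` would be properly contained in `t`.
          have hsub : edgePairs t' ⊆ edgePairs t := by
            rw [h]; exact Set.insert_subset hf Set.sdiff_subset
          have heq := (hbasis t' ht').eq_of_subset (hbasis t ht) hsub
          rw [← heq, h] at he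
          rcases he with rfl | he
          · exact hfe rfl
          · exact he.2 rfl
        · right
          refine exists_supporting_form_of_leaf ?_
          rw [isInternalEdge_iff he, not_and_or] at hint
          push Not at hint
          refine hint.imp (fun h j hj => ?_) fun h i hi => ?_
          · exact by_contra fun hne => h j hne hj
          · exact by_contra fun hne => h i hne hi) p hp
    exact ⟨t, ht, h⟩
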